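/- Let $G$ be a finite group and let $\sigma$ be a partition of the set of all primes into (nonempty, pairwise disjoint) subsets. For a set $\pi$ of primes, a finite group is a $\pi$-group if every prime divisor of its order lies in $\pi$, and $\mathfrak{G}_\pi$ denotes the class of all $\pi$-groups. A subgroup $P$ of $G$ is a $\mathfrak{G}_\pi$-projector of $G$ if for every normal subgroup $N$ of $G$ the subgroup $PN/N$ is a maximal $\pi$-subgroup of $G/N$, that is, $PN/N$ is a $\pi$-group and no subgroup of $G/N$ properly containing it is a $\pi$-group. A subgroup $H$ of $G$ is called $\sigma^{(3)}$-permutable if for every $\pi\in\sigma$ there is a $\mathfrak{G}_\pi$-projector $P$ of $G$ such that $HP^x=P^xH$ for all $x\in G$, where $P^x=x^{-1}Px$. Then the set of all $\sigma^{(3)}$-permutable subgroups of $G$ is a sublattice of the lattice of all subgroups of $G$: it is nonempty, and whenever $A$ and $B$ are $\sigma^{(3)}$-permutable subgroups of $G$, so are their intersection $A\cap B$ and their join $\langle A,B\rangle$. -/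

import Mathlib

open scoped Pointwise

universe u

namespace SigmaPerm

/-- A class of groups, given as a predicate on groups. -/
abbrev GroupClass : Type (u + 1) := (K : Type u) → [Group K] → Prop

/-- The class of all finite `π`-groups: every prime divisor of the order belongs to `π`. -/
def piGroups (π : Set Nat.Primes) : GroupClass.{u} := fun K _ =>
  Finite K ∧ ∀ p : Nat.Primes, (p : ℕ) ∣ Nat.card K → p ∈ π

/-- `H` is an `X`-maximal subgroup of `G`: it belongs to the class `X`, and no subgroup of `G`
properly containing `H` belongs to `X`. -/
def IsClassMaximal (X : GroupClass.{u}) {G : Type u} [Group G] (H : Subgroup G) : Prop :=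
  Maximal (fun K : Subgroup G => X K) H

/-- `P` is an `X`-projector of `G`: the image `PN/N` of `P` in `G/N` is an `X`-maximal subgroup
of `G/N`, for every normal subgroup `N` of `G`. -/
def IsProjector (X : GroupClass.{u}) {G : Type u} [Group G] (P : Subgroup G) : Prop :=
  ∀ (N : Subgroup G) [N.Normal], IsClassMaximal X (P.map (QuotientGroup.mk' N))

/-- `H` and `K` permute: `HK = KH` as sets of products. -/
def Permutes {G : Type u} [Group G] (H K : Subgroup G) : Prop :=
  (H : Set G) * (K : Set G) = (K : Set G) * (H : Set G)

/-- The conjugate `P ^ x = x⁻¹ P x`. -/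
def conjBy {G : Type u} [Group G] (P : Subgroup G) (x : G) : Subgroup G :=
  MulAut.conj x⁻¹ • P

/-- `H` is `σ⁽³⁾`-permutable in `G`: for every `π ∈ σ` there is a projector `P` of `G` for the class
of `π`-groups such that `H` permutes with every conjugate of `P`. -/
def IsSigma3Permutable (σ : Set (Set Nat.Primes)) {G : Type u} [Group G] (H : Subgroup G) : Prop :=
  ∀ π ∈ σ, ∃ P : Subgroup G, IsProjector (piGroups.{u} π) P ∧ ∀ x : G, Permutes H (conjBy P x)

end SigmaPerm

/-!
Fix a finite group `G`, a partition `σ` of the primes and `π ∈ σ`. Write `O^π(H)` for the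
`π`-residual of `H` (`residual π H`) and `R = O^{π'}(G)` for the subgroup generated by all
`π`-elements of `G` (`piGenerated G π`). The definition of `σ⁽³⁾`-permutability allows a different
projector for each subgroup, and projectors need not be conjugate. The point is therefore to
describe the `σ⁽³⁾`-permutable subgroups without reference to projectors.

The description (`IsSigma3Permutable.exists_normal_ge`) is this: for each `π ∈ σ`, the subgroup `R`
normalizes `O^π(H)`, and `H` lies in a subgroup `W` normalized by `R` such that
`(W ∩ R) / (O^π(H) ∩ R)` is a `π`-group. Conversely, these properties imply that `H` permutes with
every `𝔊_π`-projector `Q` of `G` (`IsProjector.permutes`): `Q` is also a projector of the normal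
subgroup `R` (`IsProjector.le_sup`), so it covers the normal `π`-section `(W ∩ R) / (O^π(H) ∩ R)`,
and `H ≤ O^π(H) Q` follows. Hence a `σ⁽³⁾`-permutable subgroup permutes with all projectors, which
gives the closure under joins. The description is inherited by intersections, which gives the
closure under meets. The trivial subgroup is `σ⁽³⁾`-permutable because projectors exist
(`exists_isProjector`).

The description rests on two facts.

* If `A` and `B` are `κ`-groups and `A` permutes with all conjugates of `B`, then `A` and `B` commute
  modulo `O_κ(G)` (`commutator_mem_of_permutes`). This follows by induction from Kegel's lemma that
  `A` or `B` lies in a proper normal subgroup unless `A B = G` (`closureIn_ne_or_closureIn_ne`).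
* If `H` permutes with all the conjugates of one projector for each `π ∈ σ`, then `O^π(H P) ≤ H` for
  the conjugates `P` of the projector for `π` (`residual_sup_le`). This goes by induction on the
  index of `H`, using a chief factor `N/N₀` of `G` with `N₀ ≤ H` and `N` not contained in `H`. Since
  `|H P : H|` is a `π`-number, what matters is `N ∩ H P`. If `N/N₀` is a `π'`-group, then
  `N ∩ H P ≤ H`. If it is a `π`-group, then the other members of `σ` show that `O^π(H N) ≤ H`.
  Otherwise two members of `σ` are involved in `N/N₀`, and this would produce a nontrivial normal
  section of `N/N₀` that is a `κ`-group for some `κ ∈ σ`, which is impossible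
  (`IsChief.le_of_isPiNumber`).

Most statements are phrased with relative indices of subgroups of the fixed group `G`, in place of
quotient groups: "`A` is a `κ`-group modulo `K`" becomes "`K.relIndex A` is a `κ`-number".
-/

namespace SigmaPerm

open Subgroup
open scoped commutatorElement

variable {G : Type u} [Group G]

/-! ### Permuting subgroups and relative indices -/

theorem permutes_iff {A B : Subgroup G} :
    Permutes A B ↔ ∀ a ∈ A, ∀ b ∈ B, ∃ b' ∈ B, ∃ a' ∈ A, a * b = b' * a' := by
  constructor
  · intro h a ha b hb
    have : a * b ∈ (B : Set G) * (A : Set G) := h ▸ Set.mul_mem_mul ha hb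
    obtain ⟨b', hb', a', ha', e⟩ := this
    exact ⟨b', hb', a', ha', e.symm⟩
  · intro h
    apply Set.Subset.antisymm
    · rintro _ ⟨a, ha, b, hb, rfl⟩
      obtain ⟨b', hb', a', ha', e⟩ := h a ha b hb
      exact ⟨b', hb', a', ha', e.symm⟩
    · rintro _ ⟨b, hb, a, ha, rfl⟩
      obtain ⟨b', hb', a', ha', e⟩ := h a⁻¹ (inv_mem ha) b⁻¹ (inv_mem hb)
      refine ⟨a'⁻¹, inv_mem ha', b'⁻¹, inv_mem hb', ?_⟩
      have := congrArg (·⁻¹) e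
      simpa using this.symm

theorem Permutes.symm {A B : Subgroup G} (h : Permutes A B) : Permutes B A := Eq.symm h

theorem permutes_of_le_normalizer {A B : Subgroup G} (h : B ≤ normalizer (A : Set G)) :
    Permutes A B := by
  refine Permutes.symm (permutes_iff.2 fun b hb a ha => ?_)
  exact ⟨b * a * b⁻¹, le_normalizer_iff.1 h b hb a ha, b, hb, by group⟩

theorem Permutes.coe_sup {A B : Subgroup G} (h : Permutes A B) :
    ((A ⊔ B : Subgroup G) : Set G) = A * B := by
  apply Set.Subset.antisymm
  · intro x hx
    rw [SetLike.mem_coe, Subgroup.sup_eq_closure_mul] at hx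
    induction hx using Subgroup.closure_induction with
    | mem x hx => exact hx
    | one => exact ⟨1, A.one_mem, 1, B.one_mem, one_mul 1⟩
    | mul x y _ _ hx hy =>
      obtain ⟨a, ha, b, hb, rfl⟩ := hx
      obtain ⟨c, hc, d, hd, rfl⟩ := hy
      obtain ⟨c', hc', b', hb', e⟩ := permutes_iff.1 h.symm b hb c hc
      refine ⟨a * c', mul_mem ha hc', b' * d, mul_mem hb' hd, ?_⟩
      calc a * c' * (b' * d) = a * (c' * b') * d := by group
        _ = a * b * (c * d) := by rw [← e]; group
    | inv x _ hx =>
      obtain ⟨a, ha, b, hb, rfl⟩ := hx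
      rw [h]
      exact ⟨b⁻¹, inv_mem hb, a⁻¹, inv_mem ha, by simp⟩
  · exact Subgroup.mul_subset (le_sup_left : A ≤ A ⊔ B) (le_sup_right : B ≤ A ⊔ B)

theorem Permutes.mem_sup {A B : Subgroup G} (h : Permutes A B) {x : G} :
    x ∈ A ⊔ B ↔ ∃ a ∈ A, ∃ b ∈ B, x = a * b := by
  rw [← SetLike.mem_coe, h.coe_sup, Set.mem_mul]
  simp only [SetLike.mem_coe, eq_comm]

theorem permutes_of_coe_sup {A B : Subgroup G} (h : ∀ x ∈ A ⊔ B, ∃ a ∈ A, ∃ b ∈ B, x = a * b) :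
    Permutes A B := by
  refine Permutes.symm (permutes_iff.2 fun b hb a ha => ?_)
  exact h (b * a) (mul_mem (mem_sup_right hb) (mem_sup_left ha))

/-- A join of subgroups permuting with `C` permutes with `C`. -/
theorem permutes_sSup {S : Set (Subgroup G)} {C : Subgroup G} (h : ∀ A ∈ S, Permutes A C) :
    Permutes (sSup S) C := by
  have key : ∀ a ∈ sSup S, ∀ c ∈ C, ∃ c' ∈ C, ∃ a' ∈ sSup S, a * c = c' * a' := by
    intro a ha
    rw [sSup_eq_iSup'] at ha
    refine Subgroup.iSup_induction (C := fun a => ∀ c ∈ C, ∃ c' ∈ C, ∃ a' ∈ sSup S,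
      a * c = c' * a') _ ha ?_ ?_ ?_
    · intro i x hx c hc
      obtain ⟨c', hc', a', ha', e⟩ := permutes_iff.1 (h i i.2) x hx c hc
      exact ⟨c', hc', a', le_sSup i.2 ha', e⟩
    · exact fun c hc => ⟨c, hc, 1, one_mem _, by simp⟩
    · intro x y hx hy c hc
      obtain ⟨c', hc', y', hy', e⟩ := hy c hc
      obtain ⟨c'', hc'', x', hx', e'⟩ := hx c' hc'
      exact ⟨c'', hc'', x' * y', mul_mem hx' hy', by rw [mul_assoc, e, ← mul_assoc, e', mul_assoc]⟩
  exact permutes_iff.2 key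

theorem Permutes.sup {A B C : Subgroup G} (hA : Permutes A C) (hB : Permutes B C) :
    Permutes (A ⊔ B) C := by
  rw [← sSup_pair]
  exact permutes_sSup (by rintro _ (rfl | rfl) <;> assumption)

theorem Permutes.conj {A B : Subgroup G} (h : Permutes A B) (g : G) :
    Permutes (MulAut.conj g • A) (MulAut.conj g • B) := by
  have := congrArg (MulAut.conj g • ·) h
  simpa only [Permutes, smul_mul', coe_pointwise_smul] using this

/-- The Dedekind law for permuting subgroups. -/
theorem Permutes.inf_right {A B X : Subgroup G} (h : Permutes A B) (hA : A ≤ X) :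
    Permutes A (B ⊓ X) := by
  refine permutes_iff.2 fun a ha b hb => ?_
  obtain ⟨b', hb', a', ha', e⟩ := permutes_iff.1 h a ha b hb.1
  refine ⟨b', ⟨hb', ?_⟩, a', ha', e⟩
  have : b' = a * b * a'⁻¹ := by rw [e]; group
  rw [this]
  exact X.mul_mem (X.mul_mem (hA ha) hb.2) (X.inv_mem (hA ha'))

/-- The Dedekind law for permuting subgroups. -/
theorem Permutes.sup_inf_le {A B X : Subgroup G} (h : Permutes A B) (hA : A ≤ X) :
    (A ⊔ B) ⊓ X ≤ A ⊔ B ⊓ X := by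
  rintro x ⟨hx, hX⟩
  obtain ⟨a, ha, b, hb, rfl⟩ := h.mem_sup.1 hx
  refine mul_mem (mem_sup_left ha) (mem_sup_right ⟨hb, ?_⟩)
  simpa using X.mul_mem (X.inv_mem (hA ha)) hX

/-- The index formula `|AB : A| = |B : A ∩ B|` for permuting subgroups. -/
theorem Permutes.relIndex_sup {A B : Subgroup G} (h : Permutes A B) :
    A.relIndex (A ⊔ B) = A.relIndex B := by
  symm
  refine Nat.card_congr (Equiv.ofBijective
    (quotientSubgroupOfEmbeddingOfLE A (le_sup_right : B ≤ A ⊔ B))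
    ⟨Function.Embedding.injective _, ?_⟩)
  intro q
  induction q using QuotientGroup.induction_on with
  | H z =>
    obtain ⟨z, hz⟩ := z
    rw [sup_comm] at hz
    obtain ⟨b, hb, a, ha, rfl⟩ := h.symm.mem_sup.1 hz
    refine ⟨QuotientGroup.mk ⟨b, hb⟩, ?_⟩
    rw [quotientSubgroupOfEmbeddingOfLE_apply_mk, QuotientGroup.eq]
    simpa [mem_subgroupOf] using ha

theorem relIndex_dvd_relIndex_of_permutes {K L M : Subgroup G} (hM : Permutes K M)
    (hL : Permutes K L) (h : M ≤ L) : K.relIndex M ∣ K.relIndex L := by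
  rw [← hM.relIndex_sup, ← hL.relIndex_sup]
  exact Dvd.intro _ (relIndex_mul_relIndex K (K ⊔ M) (K ⊔ L) le_sup_left (sup_le_sup_left h K))

theorem relIndex_dvd_relIndex_of_le_normalizer {K L M : Subgroup G}
    (hL : L ≤ normalizer (K : Set G)) (h : M ≤ L) : K.relIndex M ∣ K.relIndex L :=
  relIndex_dvd_relIndex_of_permutes (permutes_of_le_normalizer (h.trans hL))
    (permutes_of_le_normalizer hL) h

/-- The primes dividing `n` all belong to `π`. -/
def IsPiNumber (π : Set Nat.Primes) (n : ℕ) : Prop := ∀ p : Nat.Primes, (p : ℕ) ∣ n → p ∈ π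

namespace IsPiNumber

variable {π κ : Set Nat.Primes} {m n : ℕ}

theorem one : IsPiNumber π 1 := fun p hp => absurd (Nat.dvd_one.1 hp) p.2.ne_one

theorem of_dvd (h : IsPiNumber π n) (hd : m ∣ n) : IsPiNumber π m :=
  fun p hp => h p (hp.trans hd)

theorem mul (hm : IsPiNumber π m) (hn : IsPiNumber π n) : IsPiNumber π (m * n) :=
  fun p hp => (p.2.dvd_mul.1 hp).elim (hm p) (hn p)

theorem eq_one (hπ : IsPiNumber π n) (hκ : IsPiNumber κ n) (h : Disjoint π κ) : n = 1 := by
  by_contra hn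
  obtain ⟨p, hp, hd⟩ := Nat.exists_prime_and_dvd hn
  exact Set.disjoint_left.1 h (hπ ⟨p, hp⟩ hd) (hκ ⟨p, hp⟩ hd)

end IsPiNumber

section relative

variable {π κ : Set Nat.Primes} {H K L M N : Subgroup G}

theorem IsPiNumber.trans (h₁ : IsPiNumber π (H.relIndex K)) (h₂ : IsPiNumber π (K.relIndex L))
    (hHK : H ≤ K) (hKL : K ≤ L) : IsPiNumber π (H.relIndex L) := by
  rw [← relIndex_mul_relIndex H K L hHK hKL]
  exact h₁.mul h₂

theorem IsPiNumber.mono_left (h : IsPiNumber π (H.relIndex L)) (hHK : H ≤ K) :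
    IsPiNumber π (K.relIndex L) :=
  h.of_dvd (relIndex_dvd_of_le_left L hHK)

theorem IsPiNumber.mono_right (h : IsPiNumber π (H.relIndex L)) (hL : L ≤ normalizer (H : Set G))
    (hKL : K ≤ L) : IsPiNumber π (H.relIndex K) :=
  h.of_dvd (relIndex_dvd_relIndex_of_le_normalizer hL hKL)

theorem IsPiNumber.mid_left (h : IsPiNumber π (H.relIndex L)) (hHK : H ≤ K) (hKL : K ≤ L) :
    IsPiNumber π (H.relIndex K) :=
  h.of_dvd (Dvd.intro _ (relIndex_mul_relIndex H K L hHK hKL))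

theorem IsPiNumber.relIndex_inf (h₁ : IsPiNumber π (H.relIndex L))
    (h₂ : IsPiNumber π (K.relIndex L)) (hL : L ≤ normalizer (K : Set G)) :
    IsPiNumber π ((H ⊓ K).relIndex L) := by
  rw [inf_comm, ← relIndex_inf_mul_relIndex]
  exact (h₂.mono_right hL inf_le_right).mul h₁

theorem le_of_disjoint_relIndex (h₁ : IsPiNumber π (H.relIndex L))
    (h₂ : IsPiNumber κ (H.relIndex L)) (h : Disjoint π κ) : L ≤ H :=
  relIndex_eq_one.1 (h₁.eq_one h₂ h)

theorem isPiNumber_relIndex_of_le (h : L ≤ H) : IsPiNumber π (H.relIndex L) := by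
  rw [relIndex_eq_one.2 h]; exact IsPiNumber.one

end relative

/-- If `K` contains all `p`-elements of `L`, then `|L : K ∩ L|` is prime to `p`. -/
theorem not_dvd_relIndex_of_forall_mem [Finite G] {p : ℕ} (hp : p.Prime) {K L : Subgroup G}
    (h : ∀ g ∈ L, (∃ k, orderOf g = p ^ k) → g ∈ K) : ¬ p ∣ K.relIndex L := by
  have := Fact.mk hp
  obtain ⟨S⟩ : Nonempty (Sylow p L) := inferInstance
  intro hd
  have hle : (S : Subgroup L) ≤ K.subgroupOf L := by
    intro g hg
    rw [mem_subgroupOf]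
    refine h g g.2 ?_
    obtain ⟨k, hk⟩ := (IsPGroup.iff_orderOf.1 S.2) ⟨g, hg⟩
    refine ⟨k, ?_⟩
    rw [← hk, Subgroup.orderOf_mk, Subgroup.orderOf_coe]
  exact S.not_dvd_index (hd.trans (Subgroup.index_dvd_of_le hle))

/-! ### The subgroup generated by the elements of prime power order prime to `π` -/

/-- The `π`-residual `O^π(K)`: the subgroup of `K` generated by the elements of order a power of
a prime outside `π`. It is the smallest normal subgroup of `K` of `π`-index. -/
def residual (π : Set Nat.Primes) (K : Subgroup G) : Subgroup G :=
  closure {g | g ∈ K ∧ ∃ p : Nat.Primes, p ∉ π ∧ ∃ k, orderOf g = (p : ℕ) ^ k}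

section residual

variable {π : Set Nat.Primes} {K L : Subgroup G}

theorem residual_le : residual π K ≤ K := (closure_le _).2 fun _ hg => hg.1

theorem mem_residual {g : G} (hg : g ∈ K) {p : Nat.Primes} (hp : p ∉ π) {k : ℕ}
    (h : orderOf g = (p : ℕ) ^ k) : g ∈ residual π K :=
  subset_closure ⟨hg, p, hp, k, h⟩

theorem residual_mono (h : K ≤ L) : residual π K ≤ residual π L :=
  closure_mono fun _ hg => ⟨h hg.1, hg.2⟩

theorem residual_eq_of_le (h₁ : residual π L ≤ K) (h₂ : K ≤ L) : residual π K = residual π L := by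
  refine le_antisymm (residual_mono h₂) ((closure_le _).2 ?_)
  rintro g ⟨hg, p, hp, k, hk⟩
  exact mem_residual (h₁ (mem_residual hg hp hk)) hp hk

theorem normalizer_le_normalizer_residual :
    normalizer (K : Set G) ≤ normalizer (residual π K : Set G) := by
  refine le_trans ?_ (normalizer_le_normalizer_closure _)
  refine le_set_normalizer_iff.2 ?_
  rintro n hn g ⟨hg, p, hp, k, hk⟩
  refine ⟨(mem_normalizer_iff.1 hn g).1 hg, p, hp, k, ?_⟩
  rw [← hk]
  exact orderOf_injective (MulAut.conj n).toMonoidHom (MulAut.conj n).injective g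

theorem le_normalizer_residual : K ≤ normalizer (residual π K : Set G) :=
  le_normalizer.trans normalizer_le_normalizer_residual

theorem residual_le_of_le_normalizer (hL : L ≤ normalizer (K : Set G))
    (h : IsPiNumber π (K.relIndex L)) : residual π L ≤ K := by
  refine (closure_le _).2 ?_
  rintro g ⟨hg, p, hp, k, hk⟩
  have := normal_subgroupOf_of_le_normalizer hL
  have hpow : g ^ K.relIndex L ∈ K := by
    have := (K.subgroupOf L).pow_index_mem (⟨g, hg⟩ : L)
    exact mem_subgroupOf.1 this
  have hco : (orderOf g).Coprime (K.relIndex L) := by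
    rw [hk]
    exact Nat.Coprime.pow_left k ((Nat.Prime.coprime_iff_not_dvd p.2).2 fun hd => hp (h p hd))
  have hz : g ∈ zpowers (g ^ K.relIndex L) := by
    obtain ⟨m, hm⟩ := exists_pow_eq_self_of_coprime hco.symm
    exact ⟨m, by simpa using hm⟩
  exact (zpowers_le.2 hpow) hz

theorem isPiNumber_relIndex_residual [Finite G] : IsPiNumber π ((residual π K).relIndex K) := by
  intro p hp
  by_contra hπ
  refine not_dvd_relIndex_of_forall_mem p.2 ?_ hp
  rintro g hg ⟨k, hk⟩
  exact mem_residual hg hπ hk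

end residual

/-! ### Conjugation and normalizers -/

theorem le_normalizer_iff_smul_le {L K : Subgroup G} :
    L ≤ normalizer (K : Set G) ↔ ∀ g ∈ L, MulAut.conj g • K ≤ K := by
  rw [le_normalizer_iff]
  refine forall₂_congr fun g _ => ⟨?_, fun h k hk => ?_⟩
  · rintro h _ ⟨k, hk, rfl⟩
    exact h k hk
  · exact h (smul_mem_pointwise_smul k (MulAut.conj g) K hk)

theorem smul_eq_of_le_normalizer {L K : Subgroup G} (h : L ≤ normalizer (K : Set G)) {g : G}
    (hg : g ∈ L) : MulAut.conj g • K = K := by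
  refine le_antisymm (le_normalizer_iff_smul_le.1 h g hg) ?_
  rw [subset_pointwise_smul_iff, ← map_inv]
  exact le_normalizer_iff_smul_le.1 h g⁻¹ (inv_mem hg)

theorem smul_le_of_le {L K : Subgroup G} (h : K ≤ L) {g : G} (hg : g ∈ L) :
    MulAut.conj g • K ≤ L := by
  rw [← smul_eq_of_le_normalizer le_normalizer hg]
  exact pointwise_smul_le_pointwise_smul_iff.2 h

theorem relIndex_smul {H K : Subgroup G} (g : G) :
    (MulAut.conj g • H).relIndex (MulAut.conj g • K) = H.relIndex K :=
  relIndex_pointwise_smul (MulAut.conj g) H K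

theorem le_normalizer_sup {L H K : Subgroup G} (hH : L ≤ normalizer (H : Set G))
    (hK : L ≤ normalizer (K : Set G)) : L ≤ normalizer ((H ⊔ K : Subgroup G) : Set G) :=
  (le_inf hH hK).trans (normalizer_inf_normalizer_le_normalizer_sup H K)

theorem le_normalizer_inf {L H K : Subgroup G} (hH : L ≤ normalizer (H : Set G))
    (hK : L ≤ normalizer (K : Set G)) : L ≤ normalizer ((H ⊓ K : Subgroup G) : Set G) :=
  (le_inf hH hK).trans inf_normalizer_le_normalizer_inf

theorem le_normalizer_smul {L M : Subgroup G} (hM : L ≤ normalizer (M : Set G)) {g : G}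
    (hL : MulAut.conj g • L = L) : L ≤ normalizer ((MulAut.conj g • M : Subgroup G) : Set G) := by
  refine le_normalizer_iff_smul_le.2 fun x hx => ?_
  rw [← hL, mem_pointwise_smul_iff_inv_smul_mem] at hx
  have := le_normalizer_iff_smul_le.1 hM _ hx
  rw [← pointwise_smul_le_pointwise_smul_iff (a := MulAut.conj g), smul_smul, ← map_mul] at this
  rw [smul_smul, ← map_mul]
  convert! this using 3
  rw [← map_inv, MulAut.smul_def, MulAut.conj_apply]
  group

/-- The elements of `L` that commute with every element of `S` modulo the subgroup `W`, which is
normalized by `L`. -/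
def centralizerMod (L W S : Subgroup G) (h : L ≤ normalizer (W : Set G)) : Subgroup G where
  carrier := {x | x ∈ L ∧ ∀ s ∈ S, ⁅x, s⁆ ∈ W}
  one_mem' := ⟨one_mem L, fun s _ => by simp⟩
  mul_mem' := by
    rintro x y ⟨hx, hx'⟩ ⟨hy, hy'⟩
    refine ⟨mul_mem hx hy, fun s hs => ?_⟩
    have e : ⁅x * y, s⁆ = x * ⁅y, s⁆ * x⁻¹ * ⁅x, s⁆ := by simp only [commutatorElement_def]; group
    rw [e]
    exact W.mul_mem (le_normalizer_iff.1 h x hx _ (hy' s hs)) (hx' s hs)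
  inv_mem' := by
    rintro x ⟨hx, hx'⟩
    refine ⟨inv_mem hx, fun s hs => ?_⟩
    have e : ⁅x⁻¹, s⁆ = x⁻¹ * ⁅x, s⁆⁻¹ * x⁻¹⁻¹ := by simp only [commutatorElement_def]; group
    rw [e]
    exact le_normalizer_iff.1 h x⁻¹ (inv_mem hx) _ (W.inv_mem (hx' s hs))

theorem le_normalizer_of_commutator_mem {L W S : Subgroup G} (h : L ≤ normalizer (W : Set G))
    (hS : ∀ x ∈ L, ∀ s ∈ S, ⁅x, s⁆ ∈ W) : L ≤ normalizer ((S ⊔ W : Subgroup G) : Set G) := by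
  refine le_normalizer_iff_smul_le.2 fun x hx => ?_
  rw [smul_sup]
  refine sup_le ?_ ((le_normalizer_iff_smul_le.1 h x hx).trans le_sup_right)
  rintro _ ⟨s, hs, rfl⟩
  have e : x * s * x⁻¹ = ⁅x, s⁆ * s := by simp only [commutatorElement_def]; group
  change x * s * x⁻¹ ∈ S ⊔ W
  rw [e]
  exact mul_mem (mem_sup_right (hS x hx s hs)) (mem_sup_left hs)

theorem commutatorElement_mem_comm {a b : G} {W : Subgroup G} (h : ⁅a, b⁆ ∈ W) : ⁅b, a⁆ ∈ W := by
  rw [← commutatorElement_inv]; exact inv_mem h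

theorem commutatorElement_mem_of_le_normalizer {A B : Subgroup G}
    (h : B ≤ normalizer (A : Set G)) {a b : G} (ha : a ∈ A) (hb : b ∈ B) : ⁅a, b⁆ ∈ A := by
  have e : ⁅a, b⁆ = a * (b * a⁻¹ * b⁻¹) := by simp only [commutatorElement_def]; group
  rw [e]
  exact mul_mem ha (le_normalizer_iff.1 h b hb _ (inv_mem ha))

/-- The normal closure of `A` in `L`, for subgroups `A ≤ L` of a common group: the subgroup
generated by the conjugates of `A` by elements of `L`. -/
def closureIn (L A : Subgroup G) : Subgroup G := sSup {C | ∃ g ∈ L, C = MulAut.conj g • A}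

section closureIn

variable {L A N : Subgroup G}

theorem smul_le_closureIn {g : G} (hg : g ∈ L) : MulAut.conj g • A ≤ closureIn L A :=
  le_sSup ⟨g, hg, rfl⟩

theorem le_closureIn : A ≤ closureIn L A := by
  simpa using smul_le_closureIn (A := A) (one_mem L)

theorem closureIn_le_of_forall (h : ∀ g ∈ L, MulAut.conj g • A ≤ N) : closureIn L A ≤ N :=
  sSup_le (by rintro _ ⟨g, hg, rfl⟩; exact h g hg)

theorem closureIn_le (hA : A ≤ N) (hN : L ≤ normalizer (N : Set G)) : closureIn L A ≤ N :=
  closureIn_le_of_forall fun g hg => by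
    rw [← smul_eq_of_le_normalizer hN hg]
    exact pointwise_smul_le_pointwise_smul_iff.2 hA

theorem closureIn_le_self (hA : A ≤ L) : closureIn L A ≤ L := closureIn_le hA le_normalizer

theorem le_normalizer_closureIn : L ≤ normalizer (closureIn L A : Set G) := by
  refine le_normalizer_iff_smul_le.2 fun x hx => ?_
  rw [pointwise_smul_subset_iff]
  refine closureIn_le_of_forall fun g hg => ?_
  rw [← pointwise_smul_subset_iff, smul_smul, ← map_mul]
  exact smul_le_closureIn (mul_mem hx hg)

end closureIn

/-! ### The largest normal `κ`-subgroup modulo a normal subgroup -/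

/-- `W/K = O_κ(L/K)`: among the subgroups of `L` normalized by `L` whose index over `K` is a
`κ`-number, `W` is the largest. -/
structure IsRadical (κ : Set Nat.Primes) (K L W : Subgroup G) : Prop where
  le_left : K ≤ W
  le_right : W ≤ L
  le_normalizer : L ≤ normalizer (W : Set G)
  isPiNumber : IsPiNumber κ (K.relIndex W)
  le_of : ∀ V : Subgroup G, V ≤ L → L ≤ normalizer (V : Set G) → IsPiNumber κ (K.relIndex V) →
    V ≤ W

section radical

variable {κ : Set Nat.Primes} {K L W : Subgroup G}

theorem IsPiNumber.sup {V : Subgroup G} (hKW : K ≤ W) (hW : IsPiNumber κ (K.relIndex W))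
    (hV : IsPiNumber κ (K.relIndex V)) (hVW : Permutes W V) :
    IsPiNumber κ (K.relIndex (W ⊔ V)) := by
  refine hW.trans ?_ hKW le_sup_left
  rw [hVW.relIndex_sup]
  exact hV.mono_left hKW

theorem exists_isRadical [Finite G] (κ : Set Nat.Primes) (hKL : K ≤ L)
    (hL : L ≤ normalizer (K : Set G)) : ∃ W, IsRadical κ K L W := by
  obtain ⟨W, -, hW⟩ := Finite.exists_le_maximal
    (p := fun W : Subgroup G => K ≤ W ∧ W ≤ L ∧ L ≤ normalizer (W : Set G) ∧
      IsPiNumber κ (K.relIndex W)) (a := K) ⟨le_rfl, hKL, hL, isPiNumber_relIndex_of_le le_rfl⟩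
  obtain ⟨⟨h₁, h₂, h₃, h₄⟩, hmax⟩ := hW
  refine ⟨W, h₁, h₂, h₃, h₄, fun V hVL hV hκ => ?_⟩
  refine le_sup_right.trans (hmax ⟨h₁.trans le_sup_left, sup_le h₂ hVL, le_normalizer_sup h₃ hV, ?_⟩
    (le_sup_left : W ≤ W ⊔ V))
  exact h₄.sup h₁ hκ (permutes_of_le_normalizer (hVL.trans h₃))

theorem IsRadical.le_normalizer_of_le_normalizer {M : Subgroup G} (h : IsRadical κ K L W)
    (hL : M ≤ normalizer (L : Set G)) (hK : M ≤ normalizer (K : Set G)) :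
    M ≤ normalizer (W : Set G) := by
  refine le_normalizer_iff_smul_le.2 fun g hg => h.le_of _ ?_ ?_ ?_
  · rw [← smul_eq_of_le_normalizer hL hg]
    exact pointwise_smul_le_pointwise_smul_iff.2 h.le_right
  · exact le_normalizer_smul h.le_normalizer (smul_eq_of_le_normalizer hL hg)
  · rw [← smul_eq_of_le_normalizer hK hg, relIndex_smul]
    exact h.isPiNumber

end radical

/-! ### Kegel's lemma and permuting `κ`-subgroups -/

theorem Permutes.sup_smul_eq {A B L : Subgroup G} (h : Permutes A B) (hL : A ⊔ B = L) {g : G}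
    (hg : g ∈ L) : A ⊔ MulAut.conj g • B = L := by
  subst hL
  obtain ⟨a, ha, b, hb, rfl⟩ := h.mem_sup.1 hg
  rw [map_mul, ← smul_smul, smul_eq_of_le_normalizer le_normalizer hb]
  conv_lhs => rw [← smul_eq_of_le_normalizer (le_normalizer (H := A)) ha, ← smul_sup]
  exact smul_eq_of_le_normalizer le_normalizer (mem_sup_left ha)

/-- **Kegel's lemma**: if `A` permutes with all the conjugates of `B` in `L` and `AB ≠ L`, then `A`
or `B` lies in a proper normal subgroup of `L`. -/
theorem closureIn_ne_or_closureIn_ne [Finite G] {A B L : Subgroup G} (hA : A ≤ L) (hB : B ≤ L)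
    (h : ∀ g ∈ L, Permutes A (MulAut.conj g • B)) (hne : A ⊔ B ≠ L) :
    closureIn L A ≠ L ∨ closureIn L B ≠ L := by
  -- a maximal overgroup of `A` with the same properties is normalized by all conjugates of `B`
  obtain ⟨C, hAC, ⟨hCL, hC, hCB⟩, hmax⟩ := Finite.exists_le_maximal
    (p := fun C : Subgroup G => C ≤ L ∧ (∀ g ∈ L, Permutes C (MulAut.conj g • B)) ∧ C ⊔ B ≠ L)
    (a := A) ⟨hA, h, hne⟩
  have key : ∀ g ∈ L, MulAut.conj g • B ≤ normalizer (C : Set G) := by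
    intro g hg
    refine le_normalizer_iff_smul_le.2 fun x hx => ?_
    have hxL : x ∈ L := smul_le_of_le hB hg hx
    have hperm : ∀ y ∈ L, Permutes (C ⊔ MulAut.conj x • C) (MulAut.conj y • B) := by
      intro y hy
      refine (hC y hy).sup ?_
      have := (hC (x⁻¹ * y) (mul_mem (inv_mem hxL) hy)).conj x
      rwa [smul_smul, ← map_mul, mul_inv_cancel_left] at this
    refine le_sup_right.trans (hmax ⟨sup_le hCL (smul_le_of_le hCL hxL), hperm, fun heq => ?_⟩
      (le_sup_left : C ≤ C ⊔ MulAut.conj x • C))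
    have h1 : C ⊔ MulAut.conj x • C ⊔ MulAut.conj g • B = L :=
      Permutes.sup_smul_eq (by simpa using hperm 1 (one_mem L)) heq hg
    have h2 : C ⊔ MulAut.conj g • B = L := by
      refine le_antisymm (sup_le hCL (smul_le_of_le hB hg)) ?_
      rw [← h1]
      refine sup_le (sup_le le_sup_left ?_) le_sup_right
      exact smul_le_of_le le_sup_left (mem_sup_right hx)
    have h3 := (hC g hg).sup_smul_eq h2 (inv_mem hg)
    rw [smul_smul, ← map_mul, inv_mul_cancel, map_one, one_smul] at h3
    exact hCB h3
  by_contra! hcon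
  have hLC : L ≤ normalizer (C : Set G) := by
    rw [← hcon.2]; exact closureIn_le_of_forall key
  have : L ≤ C := by rw [← hcon.1]; exact closureIn_le hAC hLC
  exact hCB (le_antisymm (sup_le hCL hB) (this.trans le_sup_left))

theorem Permutes.conj_symm {A B L : Subgroup G} (h : ∀ g ∈ L, Permutes A (MulAut.conj g • B)) :
    ∀ g ∈ L, Permutes B (MulAut.conj g • A) := by
  intro g hg
  have := (h g⁻¹ (inv_mem hg)).conj g
  rw [smul_smul, ← map_mul, mul_inv_cancel, map_one, one_smul] at this
  exact this.symm

/-- The inductive step for `commutator_le_of_permutes` when the normal closure `N` of `A` in `L` is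
proper: the inductive hypothesis for `A` and the groups `B ^ g ∩ N` shows that `N` centralizes
`B ∩ N` modulo `W`. -/
theorem inf_closureIn_le_and_le_normalizer [Finite G] {κ : Set Nat.Primes} {K L A B W : Subgroup G}
    (hK : L ≤ normalizer (K : Set G)) (hBL : B ≤ L) (hWA : W ≤ A)
    (hB : IsPiNumber κ (K.relIndex B))
    (hperm : ∀ g ∈ L, Permutes A (MulAut.conj g • B)) (hW : IsRadical κ K L W)
    (hNL : closureIn L A ≤ L)
    (ih : ∀ D V : Subgroup G, D ≤ closureIn L A → IsPiNumber κ (K.relIndex D) →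
      (∀ g ∈ closureIn L A, Permutes A (MulAut.conj g • D)) → IsRadical κ K (closureIn L A) V →
      ∀ a ∈ A, ∀ d ∈ D, ⁅a, d⁆ ∈ V) :
    B ⊓ closureIn L A ≤ W ∧ ∀ g ∈ L, MulAut.conj g • B ≤ normalizer (A : Set G) := by
  set N := closureIn L A with hN
  have hLN : L ≤ normalizer (N : Set G) := le_normalizer_closureIn
  have hAN : A ≤ N := le_closureIn
  obtain ⟨V, hV⟩ := exists_isRadical κ ((hW.le_left.trans hWA).trans hAN) (hNL.trans hK)
  have hVW : V ≤ W := hW.le_of V (hV.le_right.trans hNL)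
    (hV.le_normalizer_of_le_normalizer hLN hK) hV.isPiNumber
  have h1 : ∀ g ∈ L, ∀ a ∈ A, ∀ d ∈ MulAut.conj g • B ⊓ N, ⁅a, d⁆ ∈ W := by
    intro g hg a ha d hd
    refine hVW (ih _ V inf_le_right ?_ ?_ hV a ha d hd)
    · refine IsPiNumber.mono_right ?_ ((smul_le_of_le hBL hg).trans hK) inf_le_left
      rwa [← smul_eq_of_le_normalizer hK hg, relIndex_smul]
    · intro n hn
      rw [smul_inf, smul_smul, ← map_mul, smul_eq_of_le_normalizer le_normalizer hn]
      exact (hperm _ (mul_mem (hNL hn) hg)).inf_right hAN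
  have h2 : ∀ x ∈ N, ∀ b ∈ B ⊓ N, ⁅x, b⁆ ∈ W := by
    have : N ≤ centralizerMod L W (B ⊓ N) hW.le_normalizer := by
      refine closureIn_le_of_forall ?_
      rintro g hg _ ⟨a, ha, rfl⟩
      refine ⟨hNL (smul_le_closureIn hg (smul_mem_pointwise_smul a _ A ha)), fun b hb => ?_⟩
      have e : ⁅g * a * g⁻¹, b⁆ = g * ⁅a, g⁻¹ * b * g⁻¹⁻¹⁆ * g⁻¹ := by
        simp only [commutatorElement_def]; group
      change ⁅g * a * g⁻¹, b⁆ ∈ W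
      rw [e]
      refine le_normalizer_iff.1 hW.le_normalizer g hg _ (h1 g⁻¹ (inv_mem hg) a ha _ ⟨?_, ?_⟩)
      · exact smul_mem_pointwise_smul b (MulAut.conj g⁻¹) B hb.1
      · exact le_normalizer_iff.1 hLN g⁻¹ (inv_mem hg) b hb.2
    exact fun x hx b hb => (this hx).2 b hb
  have h3 : B ⊓ N ≤ W := by
    refine le_sup_left.trans ((hV.le_of (B ⊓ N ⊔ W) (sup_le inf_le_right (hWA.trans hAN))
      (le_normalizer_of_commutator_mem (hNL.trans hW.le_normalizer) h2) ?_).trans hVW)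
    rw [sup_comm]
    refine hW.isPiNumber.sup hW.le_left (hB.mono_right (hBL.trans hK) inf_le_left) ?_
    exact permutes_of_le_normalizer ((inf_le_left.trans hBL).trans hW.le_normalizer)
  refine ⟨h3, fun g hg => le_normalizer_iff.2 fun b hb a ha => ?_⟩
  have h4 : MulAut.conj g • B ⊓ N ≤ A := by
    rw [← smul_eq_of_le_normalizer hLN hg, ← smul_inf]
    refine le_trans (pointwise_smul_le_pointwise_smul_iff.2 h3) ?_
    rw [smul_eq_of_le_normalizer hW.le_normalizer hg]
    exact hWA
  have hbL : b ∈ L := smul_le_of_le hBL hg hb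
  have : b * a * b⁻¹ ∈ (A ⊔ MulAut.conj g • B) ⊓ N :=
    ⟨Subgroup.mul_mem _ (mul_mem (mem_sup_right hb) (mem_sup_left ha))
      (inv_mem (mem_sup_right hb)), le_normalizer_iff.1 hLN b hbL a (hAN ha)⟩
  exact (((hperm g hg).sup_inf_le hAN).trans (sup_le le_rfl h4)) this

/-- Let `A` and `B` be subgroups of `L` that are `κ`-groups modulo a normal subgroup `K` of `L`.
If `A` permutes with all conjugates of `B` in `L`, then `A` and `B` commute modulo the largest
normal `κ`-subgroup of `L` modulo `K`. -/
theorem commutator_mem_of_permutes [Finite G] {κ : Set Nat.Primes} {K L A B W : Subgroup G}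
    (hK : L ≤ normalizer (K : Set G)) (hAL : A ≤ L) (hBL : B ≤ L)
    (hA : IsPiNumber κ (K.relIndex A)) (hB : IsPiNumber κ (K.relIndex B))
    (hperm : ∀ g ∈ L, Permutes A (MulAut.conj g • B)) (hW : IsRadical κ K L W) :
    ∀ a ∈ A, ∀ b ∈ B, ⁅a, b⁆ ∈ W := by
  induction hn : Nat.card L using Nat.strong_induction_on generalizing L A B W with
  | _ n ihn =>
  -- it suffices to treat subgroups containing `W`
  suffices main : ∀ A B : Subgroup G, W ≤ A → W ≤ B → A ≤ L → B ≤ L →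
      IsPiNumber κ (K.relIndex A) → IsPiNumber κ (K.relIndex B) →
      (∀ g ∈ L, Permutes A (MulAut.conj g • B)) → ∀ a ∈ A, ∀ b ∈ B, ⁅a, b⁆ ∈ W by
    intro a ha b hb
    have hpW : ∀ {C : Subgroup G}, C ≤ L → Permutes W C := fun hC =>
      permutes_of_le_normalizer (hC.trans hW.le_normalizer)
    refine main (W ⊔ A) (W ⊔ B) le_sup_left le_sup_left (sup_le hW.le_right hAL)
      (sup_le hW.le_right hBL) (hW.isPiNumber.sup hW.le_left hA (hpW hAL))
      (hW.isPiNumber.sup hW.le_left hB (hpW hBL)) (fun g hg => ?_) a (mem_sup_right ha)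
      b (mem_sup_right hb)
    rw [smul_sup, smul_eq_of_le_normalizer hW.le_normalizer hg]
    refine Permutes.sup ?_ (Permutes.symm (Permutes.sup (hpW hAL) (hperm g hg).symm))
    exact hpW (sup_le hW.le_right (smul_le_of_le hBL hg))
  clear hAL hBL hA hB hperm A B
  have half : ∀ A B : Subgroup G, W ≤ A → W ≤ B → A ≤ L → B ≤ L →
      IsPiNumber κ (K.relIndex A) → IsPiNumber κ (K.relIndex B) →
      (∀ g ∈ L, Permutes A (MulAut.conj g • B)) → closureIn L A ≠ L →
      B ⊓ closureIn L A ≤ W ∧ ∀ g ∈ L, MulAut.conj g • B ≤ normalizer (A : Set G) := by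
    intro A B hWA hWB hAL hBL hA hB hperm hne
    have hNL := closureIn_le_self hAL
    refine inf_closureIn_le_and_le_normalizer hK hBL hWA hB hperm hW hNL ?_
    intro D V hD hDκ hDp hV
    refine ihn _ ?_ (hNL.trans hK) le_closureIn hD hA hDκ hDp hV rfl
    rw [← hn]
    exact (Set.toFinite (L : Set G)).card_lt_card
      (SetLike.coe_ssubset_coe.2 (lt_of_le_of_ne hNL hne))
  have full : ∀ A B : Subgroup G, W ≤ A → W ≤ B → A ≤ L → B ≤ L →
      IsPiNumber κ (K.relIndex A) → IsPiNumber κ (K.relIndex B) →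
      (∀ g ∈ L, Permutes A (MulAut.conj g • B)) → closureIn L A ≠ L →
      ∀ a ∈ A, ∀ b ∈ B, ⁅a, b⁆ ∈ W := by
    intro A B hWA hWB hAL hBL hA hB hperm hne a ha b hb
    obtain ⟨h1, h2⟩ := half A B hWA hWB hAL hBL hA hB hperm hne
    by_cases hB' : closureIn L B = L
    · have hLA : L ≤ normalizer (A : Set G) := by
        rw [← hB']; exact closureIn_le_of_forall h2
      exact commutatorElement_mem_of_le_normalizer (hBL.trans hW.le_normalizer)
        (hW.le_of A hAL hLA hA ha) hb
    · obtain ⟨-, h4⟩ := half B A hWB hWA hBL hAL hB hA (Permutes.conj_symm hperm) hB'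
      have hBA : B ≤ normalizer (A : Set G) := by simpa using h2 1 (one_mem L)
      have hAB : A ≤ normalizer (B : Set G) := by simpa using h4 1 (one_mem L)
      refine h1 ⟨?_, le_closureIn (commutatorElement_mem_of_le_normalizer hBA ha hb)⟩
      exact commutatorElement_mem_comm (commutatorElement_mem_of_le_normalizer hAB hb ha)
  intro A B hWA hWB hAL hBL hA hB hperm a ha b hb
  by_cases hAB : A ⊔ B = L
  · have hL : L ≤ W := by
      refine hW.le_of L le_rfl le_normalizer ?_
      rw [← hAB]
      exact hA.sup (hW.le_left.trans hWA) hB (by simpa using hperm 1 (one_mem L))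
    exact hL (mul_mem (mul_mem (mul_mem (hAL ha) (hBL hb)) (inv_mem (hAL ha))) (inv_mem (hBL hb)))
  · rcases closureIn_ne_or_closureIn_ne hAL hBL hperm hAB with h | h
    · exact full A B hWA hWB hAL hBL hA hB hperm h a ha b hb
    · exact commutatorElement_mem_comm
        (full B A hWB hWA hBL hAL hB hA (Permutes.conj_symm hperm) h b hb a ha)

/-! ### Chief factors -/

/-- `N/N₀` is a chief factor of `G`, or trivial: `N₀ ≤ N` are normal subgroups of `G`, and each
normal subgroup of `G` properly contained in `N` is contained in `N₀`. -/
structure IsChief (N₀ N : Subgroup G) : Prop where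
  normal_left : N₀.Normal
  normal_right : N.Normal
  le : N₀ ≤ N
  eq_or_le : ∀ M : Subgroup G, M.Normal → M ≤ N → M = N ∨ M ≤ N₀

theorem isPiNumber_relIndex_of_card {π : Set Nat.Primes} {K P : Subgroup G}
    (h : IsPiNumber π (Nat.card P)) : IsPiNumber π (K.relIndex P) :=
  h.of_dvd (relIndex_dvd_card K P)

theorem isPiNumber_orderOf_of_eq_pow {π : Set Nat.Primes} {p : Nat.Primes} (hp : p ∈ π) {g : G}
    {k : ℕ} (h : orderOf g = (p : ℕ) ^ k) : IsPiNumber π (orderOf g) := by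
  intro q hq
  rw [h] at hq
  rwa [Subtype.ext ((Nat.prime_dvd_prime_iff_eq q.2 p.2).1 (q.2.dvd_of_dvd_pow hq))]

theorem relIndex_inf_of_le {H K L : Subgroup G} (h : L ≤ K) :
    (H ⊓ K).relIndex L = H.relIndex L := by
  rw [← inf_relIndex_right (H := H ⊓ K), inf_assoc, inf_eq_right.2 h, inf_relIndex_right]

theorem IsRadical.normal {κ : Set Nat.Primes} {K L W : Subgroup G} (h : IsRadical κ K L W)
    (hK : K.Normal) (hL : L.Normal) : W.Normal := by
  rw [← normalizer_eq_top_iff, eq_top_iff]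
  exact h.le_normalizer_of_le_normalizer le_normalizer_of_normal le_normalizer_of_normal

theorem normal_closureIn_top {M : Subgroup G} : (closureIn ⊤ M).Normal :=
  normalizer_eq_top_iff.1 (top_le_iff.1 le_normalizer_closureIn)

/-- A chief factor `N/N₀` that is not a `κ`-group has no nontrivial normal section `V/U` that is a
`κ`-group. Indeed `N/N₀` has no nontrivial normal `κ`-subgroup, and it is generated by the
conjugates of a minimal normal subgroup; each of these lies in `U` or centralizes `V`. So
`V = U Z` with `Z/N₀` central in `V/N₀`, and the `κ`-part of `Z/N₀` is trivial. -/
theorem IsChief.le_of_isPiNumber [Finite G] {κ : Set Nat.Primes} {N₀ N U V : Subgroup G}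
    (hN : IsChief N₀ N) (hκ : ¬ IsPiNumber κ (N₀.relIndex N)) (hU₀ : N₀ ≤ U) (hUV : U ≤ V)
    (hVN : V ≤ N) (hU : N ≤ normalizer (U : Set G)) (hV : N ≤ normalizer (V : Set G))
    (h : IsPiNumber κ (U.relIndex V)) : V ≤ U := by
  have hN₀n := hN.normal_left
  have hNn := hN.normal_right
  have hN₀ : ∀ {L : Subgroup G}, L ≤ normalizer (N₀ : Set G) := by
    intro L; exact le_normalizer_of_normal
  have hrad : ∀ D : Subgroup G, D ≤ N → N ≤ normalizer (D : Set G) →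
      IsPiNumber κ (N₀.relIndex D) → D ≤ N₀ := by
    obtain ⟨W, hW⟩ := exists_isRadical κ hN.le hN₀
    have hWN₀ : W ≤ N₀ := (hN.eq_or_le W (hW.normal hN₀n hNn) hW.le_right).resolve_left
      fun e => hκ (e ▸ hW.isPiNumber)
    exact fun D h1 h2 h3 => (hW.le_of D h1 h2 h3).trans hWN₀
  have hNN₀ : ¬ N ≤ N₀ := fun hle => hκ (isPiNumber_relIndex_of_le hle)
  obtain ⟨M, -, ⟨hM₀, hMN, hMne, hM⟩, hmin⟩ := Finite.exists_le_minimal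
    (p := fun M : Subgroup G => N₀ ≤ M ∧ M ≤ N ∧ ¬ M ≤ N₀ ∧ N ≤ normalizer (M : Set G)) (a := N)
    ⟨hN.le, le_rfl, hNN₀, le_normalizer⟩
  have hconj : ∀ {K : Subgroup G} [K.Normal] (g : G), MulAut.conj g • K = K := fun g =>
    Normal.conj_smul_eq_self g _
  have hgmin : ∀ (g : G) (D : Subgroup G), N₀ ≤ D → D ≤ MulAut.conj g • M →
      N ≤ normalizer (D : Set G) → D ≤ N₀ ∨ MulAut.conj g • M ≤ D := by
    intro g D h1 h2 h3
    by_contra! hcon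
    refine hcon.2 (pointwise_smul_subset_iff.2 ?_)
    rw [subset_pointwise_smul_iff] at h2
    rw [← map_inv] at h2 ⊢
    refine hmin ⟨?_, h2.trans hMN, fun h4 => hcon.1 ?_, le_normalizer_smul h3 (hconj _)⟩ h2
    · rw [← hconj (K := N₀) g⁻¹]
      exact pointwise_smul_le_pointwise_smul_iff.2 h1
    · rwa [← hconj (K := N₀) g⁻¹, pointwise_smul_le_pointwise_smul_iff] at h4
  have hgen : closureIn ⊤ M = N := by
    refine (hN.eq_or_le _ normal_closureIn_top ?_).resolve_right fun h1 => hMne ?_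
    · exact closureIn_le hMN le_normalizer_of_normal
    · exact le_closureIn.trans h1
  set C := centralizerMod N N₀ V hN₀ with hC
  have hNUC : N ≤ U ⊔ C := by
    rw [← hgen]
    refine closureIn_le_of_forall fun g _ => ?_
    have hgN : MulAut.conj g • M ≤ N := by
      rw [← hconj (K := N) g]
      exact pointwise_smul_le_pointwise_smul_iff.2 hMN
    have hgn : N ≤ normalizer ((MulAut.conj g • M : Subgroup G) : Set G) :=
      le_normalizer_smul hM (hconj g)
    have hg₀ : N₀ ≤ MulAut.conj g • M := by
      rw [← hconj (K := N₀) g]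
      exact pointwise_smul_le_pointwise_smul_iff.2 hM₀
    rcases hgmin g (V ⊓ MulAut.conj g • M) (le_inf (hU₀.trans hUV) hg₀) inf_le_right
      (le_normalizer_inf hV hgn) with h1 | h1
    · refine le_sup_of_le_right fun x hx => ⟨hgN hx, fun v hv => h1 ⟨?_, ?_⟩⟩
      · exact commutatorElement_mem_comm (commutatorElement_mem_of_le_normalizer hV hv (hgN hx))
      · exact commutatorElement_mem_of_le_normalizer hgn hx (hVN hv)
    · refine le_sup_of_le_left ?_
      have hgV : MulAut.conj g • M ≤ V := h1.trans inf_le_left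
      refine ((hgmin g (U ⊓ MulAut.conj g • M) (le_inf hU₀ hg₀) inf_le_right
        (le_normalizer_inf hU hgn)).resolve_left fun h2 => hMne ?_).trans inf_le_left
      have h3 : MulAut.conj g • M ≤ N₀ := by
        refine hrad _ hgN hgn ?_
        rw [le_antisymm (le_inf hU₀ hg₀) h2, inf_relIndex_right]
        exact h.mono_right (hVN.trans hU) hgV
      rwa [← hconj (K := N₀) g, pointwise_smul_le_pointwise_smul_iff] at h3
  have hC₀ : N₀ ≤ C := fun x hx => ⟨hN.le hx, fun v _ =>
    commutatorElement_mem_of_le_normalizer (hN₀ (L := ⊤)) hx (mem_top v)⟩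
  have hCn : N ≤ normalizer (C : Set G) := by
    refine le_normalizer_iff.2 fun n hn x hx => ⟨?_, fun v hv => ?_⟩
    · exact mul_mem (mul_mem hn hx.1) (inv_mem hn)
    · have e : ⁅n * x * n⁻¹, v⁆ = n * ⁅x, n⁻¹ * v * n⁻¹⁻¹⁆ * n⁻¹ := by
        simp only [commutatorElement_def]; group
      rw [e]
      exact hN₀n.conj_mem _ (hx.2 _ (le_normalizer_iff.1 hV n⁻¹ (inv_mem hn) v hv)) n
  set Z := C ⊓ V with hZ
  have hVZ : V = U ⊔ Z := by
    refine le_antisymm ?_ (sup_le hUV inf_le_right)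
    have hp : Permutes U C := permutes_of_le_normalizer fun x hx => hU hx.1
    exact (le_inf (hVN.trans hNUC) le_rfl).trans (hp.sup_inf_le hUV)
  have hZ₀ : N₀ ≤ Z := le_inf hC₀ (hU₀.trans hUV)
  obtain ⟨Y, hY⟩ := exists_isRadical κ hZ₀ hN₀
  have hYN₀ : Y ≤ N₀ := hrad Y (hY.le_right.trans (inf_le_right.trans hVN))
    (hY.le_normalizer_of_le_normalizer (le_normalizer_inf hCn hV) hN₀) hY.isPiNumber
  by_contra hcon
  obtain ⟨p, hp, hd⟩ := Nat.exists_prime_and_dvd (mt relIndex_eq_one.1 hcon)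
  have hpκ := h ⟨p, hp⟩ hd
  have hUZ : Permutes U Z := permutes_of_le_normalizer ((inf_le_right.trans hVN).trans hU)
  rw [hVZ, hUZ.relIndex_sup] at hd
  refine not_dvd_relIndex_of_forall_mem hp ?_ (hd.trans (relIndex_dvd_of_le_left Z hU₀))
  rintro g hg ⟨k, hk⟩
  refine hYN₀ (hY.le_of (zpowers g ⊔ N₀) (sup_le (zpowers_le.2 hg) hZ₀) ?_ ?_
    (mem_sup_left (mem_zpowers g)))
  · refine le_normalizer_of_commutator_mem hN₀ fun x hx s hs => ?_
    exact hx.1.2 s (zpowers_le.2 hg.2 hs)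
  · rw [sup_comm, (permutes_of_le_normalizer hN₀).relIndex_sup]
    refine isPiNumber_relIndex_of_card ?_
    rw [Nat.card_zpowers]
    exact isPiNumber_orderOf_of_eq_pow (p := ⟨p, hp⟩) hpκ hk

/-! ### Subgroups permuting with families of `π`-subgroups -/

/-- A conjugation-invariant family of `π`-subgroups whose join contains all `π`-elements of `G`. -/
structure IsGeneratingFamily (π : Set Nat.Primes) (S : Set (Subgroup G)) : Prop where
  smul_mem : ∀ P ∈ S, ∀ g : G, MulAut.conj g • P ∈ S
  isPiNumber_card : ∀ P ∈ S, IsPiNumber π (Nat.card P)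
  mem_sSup : ∀ g : G, IsPiNumber π (orderOf g) → g ∈ sSup S

section family

variable {π : Set Nat.Primes} {S : Set (Subgroup G)} {H : Subgroup G}

theorem IsGeneratingFamily.normal_sSup (hS : IsGeneratingFamily π S) : (sSup S).Normal := by
  rw [← normalizer_eq_top_iff, eq_top_iff]
  refine le_normalizer_iff_smul_le.2 fun g _ => ?_
  rw [pointwise_smul_subset_iff]
  refine sSup_le fun P hP => ?_
  rw [← pointwise_smul_subset_iff]
  exact le_sSup (hS.smul_mem P hP g)

theorem IsGeneratingFamily.le_sSup_of_dvd [Finite G] (hS : IsGeneratingFamily π S)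
    {N₀ N : Subgroup G} (hN : IsChief N₀ N) {p : Nat.Primes} (hp : p ∈ π)
    (hd : (p : ℕ) ∣ N₀.relIndex N) : N ≤ sSup S := by
  have := hS.normal_sSup
  have := hN.normal_right
  rcases hN.eq_or_le (sSup S ⊓ N) inferInstance inf_le_right with h | h
  · exact h ▸ inf_le_left
  · refine absurd hd (not_dvd_relIndex_of_forall_mem p.2 ?_)
    rintro g hg ⟨k, hk⟩
    exact h ⟨hS.mem_sSup g (isPiNumber_orderOf_of_eq_pow hp hk), hg⟩

/-- Suppose that `H` permutes with the members of a generating family of `π`-subgroups and contains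
the `π`-residuals of the products `H P`. Then the join `R` of the family normalizes `O^π(H)`, and
`H` lies in a normal `π`-subgroup of `H R` modulo `O^π(H)`. -/
theorem IsGeneratingFamily.exists_normal_ge [Finite G] (hS : IsGeneratingFamily π S)
    (hH : ∀ P ∈ S, Permutes H P) (hres : ∀ P ∈ S, residual π (H ⊔ P) ≤ H) :
    H ⊔ sSup S ≤ normalizer (residual π H : Set G) ∧
      ∃ W, H ≤ W ∧ W ≤ H ⊔ sSup S ∧ H ⊔ sSup S ≤ normalizer (W : Set G) ∧
        IsPiNumber π ((residual π H).relIndex W) := by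
  have hK : H ⊔ sSup S ≤ normalizer (residual π H : Set G) := by
    refine sup_le le_normalizer_residual (sSup_le fun P hP => ?_)
    rw [residual_eq_of_le (hres P hP) le_sup_left]
    exact le_sup_right.trans le_normalizer_residual
  refine ⟨hK, ?_⟩
  obtain ⟨W, hW⟩ := exists_isRadical π (residual_le.trans le_sup_left) hK
  have hSW : sSup S ≤ centralizerMod (H ⊔ sSup S) W H hW.le_normalizer := by
    refine sSup_le fun P hP x hx => ⟨mem_sup_right (le_sSup hP hx), fun h hh => ?_⟩
    exact commutatorElement_mem_comm (commutator_mem_of_permutes hK le_sup_left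
      ((le_sSup hP).trans le_sup_right) isPiNumber_relIndex_residual
      (isPiNumber_relIndex_of_card (hS.isPiNumber_card P hP))
      (fun g _ => hH _ (hS.smul_mem P hP g)) hW h hh x hx)
  refine ⟨W, le_sup_left.trans (hW.le_of (H ⊔ W) (sup_le le_sup_left hW.le_right) ?_ ?_),
    hW.le_right, hW.le_normalizer, hW.isPiNumber⟩
  · refine sup_le (le_sup_left.trans le_normalizer) ?_
    exact le_normalizer_of_commutator_mem (le_sup_right.trans hW.le_normalizer)
      fun x hx s hs => (hSW hx).2 s hs
  · rw [sup_comm]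
    exact hW.isPiNumber.sup hW.le_left isPiNumber_relIndex_residual
      (permutes_of_le_normalizer (le_sup_left.trans hW.le_normalizer))

end family

/-! ### `π`-residuals of the products `H P` -/

theorem Permutes.sup_right_normal {H N P : Subgroup G} [N.Normal] (h : Permutes H P) :
    Permutes (H ⊔ N) P :=
  h.sup (permutes_of_le_normalizer le_normalizer_of_normal)

/-- Let `N` be normal. If `N ∩ H P ≤ H` and `H N` contains `O^π(H N P)`, then `H` contains
`O^π(H P)`. -/
theorem residual_sup_le_of_inf_le {π : Set Nat.Primes} {H N P : Subgroup G} [N.Normal]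
    (hHN : residual π (H ⊔ N ⊔ P) ≤ H ⊔ N) (h : N ⊓ (H ⊔ P) ≤ H) : residual π (H ⊔ P) ≤ H := by
  have h1 : residual π (H ⊔ P) ≤ H ⊔ N :=
    (residual_mono (sup_le_sup_right le_sup_left P)).trans hHN
  have hp : Permutes H N := (permutes_of_le_normalizer le_normalizer_of_normal).symm
  exact (le_inf h1 residual_le).trans
    ((hp.sup_inf_le le_sup_left).trans (sup_le le_rfl h))

theorem isPiNumber_relIndex_inf_of_le_sup {π : Set Nat.Primes} {H N P Y : Subgroup G} [N.Normal]
    (hHP : Permutes H P) (hP : IsPiNumber π (Nat.card P)) (hY : Y ≤ H ⊔ P)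
    (hHY : H ≤ normalizer (Y : Set G)) : IsPiNumber π (H.relIndex (N ⊓ Y)) := by
  have hX : IsPiNumber π (H.relIndex (H ⊔ P)) := by
    rw [hHP.relIndex_sup]
    exact isPiNumber_relIndex_of_card hP
  refine hX.of_dvd (relIndex_dvd_relIndex_of_permutes ?_ ?_ (inf_le_right.trans hY))
  · exact (permutes_of_le_normalizer (le_normalizer_inf le_normalizer_of_normal hHY)).symm
  · refine permutes_of_coe_sup fun x hx => ⟨1, one_mem H, x, ?_, by simp⟩
    rwa [sup_eq_right.2 (le_sup_left : H ≤ H ⊔ P)] at hx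

theorem inf_sup_le_of_isPiNumber_compl {π : Set Nat.Primes} {H N₀ N P : Subgroup G}
    (hN : IsChief N₀ N) (hN₀ : N₀ ≤ H) (hπ : IsPiNumber πᶜ (N₀.relIndex N))
    (hHP : Permutes H P) (hP : IsPiNumber π (Nat.card P)) : N ⊓ (H ⊔ P) ≤ H := by
  have := hN.normal_left
  have := hN.normal_right
  refine le_of_disjoint_relIndex
    (isPiNumber_relIndex_inf_of_le_sup hHP hP le_rfl (le_sup_left.trans le_normalizer)) ?_
    (disjoint_compl_right (a := π))
  exact (hπ.mono_right le_normalizer_of_normal inf_le_left).mono_left hN₀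

/-- The final step when `N` is a `π`-group modulo `N₀`: it is enough to bound `O^π(H N)`. -/
theorem residual_sup_le_of_residual_sup_le {π : Set Nat.Primes} {H N P : Subgroup G}
    (hHN : residual π (H ⊔ N ⊔ P) ≤ H ⊔ N) (h : residual π (H ⊔ N) ≤ H) :
    residual π (H ⊔ P) ≤ H := by
  have h1 : residual π (H ⊔ P) ≤ H ⊔ N :=
    (residual_mono (sup_le_sup_right le_sup_left P)).trans hHN
  rw [← residual_eq_of_le (le_inf residual_le h1) inf_le_left]
  exact (residual_mono inf_le_right).trans h

section family

variable {ι : Type*} {π : ι → Set Nat.Primes} {S : ι → Set (Subgroup G)}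

/-- The case of a chief factor `N/N₀` that is a `π i`-group: then `H` contains `O^{π i}(H N)`. -/
theorem residual_sup_le_of_isPiNumber [Finite G] (hS : ∀ i, IsGeneratingFamily (π i) (S i))
    (hdisj : Pairwise fun i j => Disjoint (π i) (π j)) (hcov : ∀ p, ∃ i, p ∈ π i)
    {H N₀ N : Subgroup G} (hN : IsChief N₀ N) (hN₀ : N₀ ≤ H)
    (hH : ∀ i, ∀ P ∈ S i, Permutes H P)
    (hHN : ∀ i, ∀ P ∈ S i, residual (π i) (H ⊔ N ⊔ P) ≤ H ⊔ N) {i : ι}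
    (hi : IsPiNumber (π i) (N₀.relIndex N)) : residual (π i) (H ⊔ N) ≤ H := by
  have hN₀n := hN.normal_left
  have hNn := hN.normal_right
  have hN₀' : ∀ {L : Subgroup G}, L ≤ normalizer (N₀ : Set G) := by
    intro L; exact le_normalizer_of_normal
  by_cases hj : ∃ j, j ≠ i ∧ N ≤ sSup (S j)
  · -- a normal `π j`-subgroup of `H N` modulo `O^{π j}(H)` contains `H`, so `N` normalizes `H`
    obtain ⟨j, hji, hNj⟩ := hj
    have hgood : ∀ P ∈ S j, residual (π j) (H ⊔ P) ≤ H := fun P hP => by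
      refine residual_sup_le_of_inf_le (hHN j P hP) (inf_sup_le_of_isPiNumber_compl hN hN₀ ?_
        (hH j P hP) ((hS j).isPiNumber_card P hP))
      exact fun p hp => Set.disjoint_left.1 (hdisj hji.symm) (hi p hp)
    obtain ⟨hK, W, hHW, hWL, hWn, hW⟩ := (hS j).exists_normal_ge (hH j) hgood
    have hWN : W ⊓ N ≤ H := by
      refine le_of_disjoint_relIndex ?_ ?_ (hdisj hji.symm)
      · exact (hi.mono_right hN₀' inf_le_right).mono_left hN₀
      · exact (hW.mono_right (hWL.trans hK) inf_le_left).mono_left residual_le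
    have hnorm : N ≤ normalizer (H : Set G) := by
      have := le_normalizer_of_commutator_mem (L := N) (W := N ⊓ W) (S := H)
        (le_normalizer_inf le_normalizer_of_normal ((hNj.trans le_sup_right).trans hWn))
        fun x hx s hs => ⟨?_, ?_⟩
      · rwa [sup_eq_left.2 (inf_comm N W ▸ hWN)] at this
      · exact commutatorElement_mem_of_le_normalizer le_normalizer_of_normal hx hs
      · exact commutatorElement_mem_comm (commutatorElement_mem_of_le_normalizer
          ((hNj.trans le_sup_right).trans hWn) (hHW hs) hx)
    refine residual_le_of_le_normalizer (sup_le le_normalizer hnorm) ?_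
    rw [(permutes_of_le_normalizer hnorm).relIndex_sup]
    exact hi.mono_left hN₀
  · -- `N` centralizes the elements of `H` of prime power order prime to `π i`, modulo `N₀`
    push Not at hj
    have hcen : residual (π i) H ≤ centralizerMod H N₀ N hN₀' := by
      refine (closure_le _).2 ?_
      rintro g ⟨hg, p, hp, k, hk⟩
      refine ⟨hg, fun n hn => ?_⟩
      obtain ⟨j, hpj⟩ := hcov p
      have hji : j ≠ i := by rintro rfl; exact hp hpj
      have := (hS j).normal_sSup
      have hle := (hN.eq_or_le (sSup (S j) ⊓ N) inferInstance inf_le_right).resolve_left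
        fun h => hj j hji (h ▸ inf_le_left)
      refine hle ⟨?_, ?_⟩
      · exact commutatorElement_mem_of_le_normalizer (le_normalizer_of_normal (K := ⊤))
          ((hS j).mem_sSup g (isPiNumber_orderOf_of_eq_pow hpj hk)) (mem_top n)
      · exact commutatorElement_mem_comm (commutatorElement_mem_of_le_normalizer
          (le_normalizer_of_normal (K := ⊤)) hn (mem_top g))
    set Y := residual (π i) H ⊔ N₀ with hY
    have hYH : Y ≤ H := sup_le residual_le hN₀
    have hNY : N ≤ normalizer (Y : Set G) := le_normalizer_of_commutator_mem hN₀'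
      fun x hx s hs => commutatorElement_mem_comm ((hcen hs).2 x hx)
    have hHY : H ≤ normalizer (Y : Set G) := le_normalizer_sup le_normalizer_residual hN₀'
    have h1 : residual (π i) (H ⊔ N) ≤ Y ⊔ N := by
      refine residual_le_of_le_normalizer (sup_le (le_normalizer_sup hHY le_normalizer_of_normal)
        (le_sup_right.trans le_normalizer)) ?_
      have hp : Permutes (Y ⊔ N) H :=
        permutes_of_le_normalizer (le_normalizer_sup hHY le_normalizer_of_normal)
      have : H ⊔ N = (Y ⊔ N) ⊔ H := by
        rw [sup_right_comm, sup_eq_right.2 hYH]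
      rw [this, hp.relIndex_sup]
      exact isPiNumber_relIndex_residual.mono_left (le_sup_left.trans le_sup_left)
    have h2 : residual (π i) (Y ⊔ N) ≤ Y := by
      refine residual_le_of_le_normalizer (sup_le le_normalizer hNY) ?_
      rw [(permutes_of_le_normalizer hNY).relIndex_sup]
      exact hi.mono_left le_sup_right
    rw [← residual_eq_of_le h1 (sup_le_sup_right hYH N)]
    exact h2.trans hYH

/-- Suppose that primes from two different `π i` and `π j` divide `|N : N₀|`, so that `N` lies in the
joins of both `S i` and `S j`. If `X` contains all residuals `O^{π k}(X P)`, then `N` normalizes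
`N ∩ X`, since this is the product of its subgroups `O^{π i}(X) ∩ N` and `O^{π j}(X) ∩ N`. -/
theorem le_normalizer_inf_of_dvd [Finite G] (hS : ∀ i, IsGeneratingFamily (π i) (S i))
    (hdisj : Pairwise fun i j => Disjoint (π i) (π j)) {N₀ N X : Subgroup G} (hN : IsChief N₀ N)
    (hX : ∀ i, ∀ P ∈ S i, Permutes X P) (hres : ∀ i, ∀ P ∈ S i, residual (π i) (X ⊔ P) ≤ X)
    {i j : ι} (hij : i ≠ j) {p q : Nat.Primes} (hp : p ∈ π i) (hq : q ∈ π j)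
    (hpN : (p : ℕ) ∣ N₀.relIndex N) (hqN : (q : ℕ) ∣ N₀.relIndex N) :
    N ≤ normalizer ((N ⊓ X : Subgroup G) : Set G) := by
  have hNn := hN.normal_right
  have key : ∀ k, N ≤ sSup (S k) →
      N ≤ normalizer ((residual (π k) X ⊓ N : Subgroup G) : Set G) ∧
      IsPiNumber (π k) ((residual (π k) X ⊓ N).relIndex (N ⊓ X)) := by
    intro k hk
    have hK := ((hS k).exists_normal_ge (hX k) (hres k)).1
    refine ⟨le_normalizer_inf ((hk.trans le_sup_right).trans hK) le_normalizer_of_normal, ?_⟩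
    rw [relIndex_inf_of_le inf_le_left]
    exact isPiNumber_relIndex_residual.mono_right le_normalizer_residual inf_le_right
  obtain ⟨hi, hi'⟩ := key i ((hS i).le_sSup_of_dvd hN hp hpN)
  obtain ⟨hj, hj'⟩ := key j ((hS j).le_sSup_of_dvd hN hq hqN)
  have hle : ∀ k, residual (π k) X ⊓ N ≤ N ⊓ X := fun k =>
    le_inf inf_le_right (inf_le_left.trans residual_le)
  have : N ⊓ X = (residual (π i) X ⊓ N) ⊔ (residual (π j) X ⊓ N) :=
    le_antisymm (le_of_disjoint_relIndex (hi'.mono_left le_sup_left) (hj'.mono_left le_sup_right)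
      (hdisj hij)) (sup_le (hle i) (hle j))
  rw [this]
  exact le_normalizer_sup hi hj

/-- If `H` does not contain `O^π(H P)`, then passing to the normal closure of `H` in `H P` yields a
normal subgroup `A` of `N` that has `π`-index over `H ∩ N` and is not contained in `H`. -/
theorem exists_le_normalizer_not_le [Finite G] (hS : ∀ i, IsGeneratingFamily (π i) (S i))
    (hdisj : Pairwise fun i j => Disjoint (π i) (π j)) {H N₀ N : Subgroup G} (hN : IsChief N₀ N)
    (hH : ∀ i, ∀ P ∈ S i, Permutes H P)
    (ih : ∀ X, H < X → (∀ i, ∀ P ∈ S i, Permutes X P) →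
      ∀ i, ∀ P ∈ S i, residual (π i) (X ⊔ P) ≤ X)
    (hHN : ∀ i, ∀ P ∈ S i, residual (π i) (H ⊔ N ⊔ P) ≤ H ⊔ N)
    {i j : ι} (hij : i ≠ j) {p q : Nat.Primes} (hp : p ∈ π i) (hq : q ∈ π j)
    (hpN : (p : ℕ) ∣ N₀.relIndex N) (hqN : (q : ℕ) ∣ N₀.relIndex N)
    {P : Subgroup G} (hP : P ∈ S i) (hbad : ¬ residual (π i) (H ⊔ P) ≤ H) :
    ∃ A, N ⊓ H ≤ A ∧ A ≤ N ∧ N ≤ normalizer (A : Set G) ∧ ¬ A ≤ H ∧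
      IsPiNumber (π i) ((N ⊓ H).relIndex A) := by
  have hNn := hN.normal_right
  set X := H ⊔ P with hX
  have hHX : IsPiNumber (π i) (H.relIndex X) := by
    rw [(hH i P hP).relIndex_sup]
    exact isPiNumber_relIndex_of_card ((hS i).isPiNumber_card P hP)
  set Y := closureIn X H with hYdef
  have hYX : Y ≤ X := closureIn_le_self le_sup_left
  have hXY : X ≤ normalizer (Y : Set G) := le_normalizer_closureIn
  have hYp : ∀ k, ∀ Q ∈ S k, Permutes Y Q := by
    intro k Q hQ
    refine permutes_sSup ?_
    rintro _ ⟨g, -, rfl⟩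
    have := (hH k _ ((hS k).smul_mem Q hQ g⁻¹)).conj g
    rwa [smul_smul, ← map_mul, mul_inv_cancel, map_one, one_smul] at this
  have hHY : H < Y := by
    refine lt_of_le_of_ne le_closureIn fun h => hbad ?_
    exact residual_le_of_le_normalizer (h ▸ hXY) hHX
  refine ⟨N ⊓ Y, inf_le_inf_left N le_closureIn, inf_le_left,
    le_normalizer_inf_of_dvd hS hdisj hN hYp (ih Y hHY hYp) hij hp hq hpN hqN,
    fun hle => hbad ?_, ?_⟩
  · have h1 : residual (π i) X ≤ Y :=
      residual_le_of_le_normalizer hXY (hHX.mono_left le_closureIn)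
    have h2 : residual (π i) X ≤ H ⊔ N :=
      (residual_mono (sup_le_sup_right le_sup_left P)).trans (hHN i P hP)
    have hp : Permutes H N := (permutes_of_le_normalizer le_normalizer_of_normal).symm
    exact (le_inf h2 h1).trans ((hp.sup_inf_le le_closureIn).trans (sup_le le_rfl hle))
  · rw [inf_comm, relIndex_inf_of_le inf_le_left]
    exact isPiNumber_relIndex_inf_of_le_sup (hH i P hP) ((hS i).isPiNumber_card P hP) hYX
      (le_sup_left.trans hXY)

/-- If `H` permutes with all members of all the families `S i`, then `H` contains `O^{π i}(H P)` for
each `P` in `S i`. The proof is by induction on the index of `H`, and uses a chief factor `N/N₀` of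
`G` with `N₀ ≤ H` and `N` not contained in `H`; the residuals of the larger subgroups `H N`
and of the normal closure of `H` in `H P` are under control. -/
theorem residual_sup_le [Finite G] (hS : ∀ i, IsGeneratingFamily (π i) (S i))
    (hdisj : Pairwise fun i j => Disjoint (π i) (π j)) (hcov : ∀ p, ∃ i, p ∈ π i)
    (H : Subgroup G) (hH : ∀ i, ∀ P ∈ S i, Permutes H P) :
    ∀ i, ∀ P ∈ S i, residual (π i) (H ⊔ P) ≤ H := by
  induction H using WellFoundedGT.induction with
  | ind H ih =>
  intro i P hP
  by_cases htop : H = ⊤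
  · rw [htop]; exact le_top
  obtain ⟨N, -, ⟨hNn, hNH⟩, hmin⟩ := Finite.exists_le_minimal
    (p := fun N : Subgroup G => N.Normal ∧ ¬ N ≤ H) (a := ⊤)
    ⟨inferInstance, fun h => htop (top_le_iff.1 h)⟩
  set N₀ := H.normalCore ⊓ N with hN₀def
  have hN₀ : N₀ ≤ H := inf_le_left.trans H.normalCore_le
  have hN : IsChief N₀ N := by
    refine ⟨inferInstance, hNn, inf_le_right, fun M hM hMN => ?_⟩
    by_cases hMH : M ≤ H
    · exact Or.inr (le_inf (normal_le_normalCore.2 hMH) hMN)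
    · exact Or.inl (le_antisymm hMN (hmin ⟨hM, hMH⟩ hMN))
  have hHN : ∀ i, ∀ P ∈ S i, residual (π i) (H ⊔ N ⊔ P) ≤ H ⊔ N :=
    ih (H ⊔ N) (left_lt_sup.2 hNH) fun i P hP => (hH i P hP).sup_right_normal
  by_cases h1 : IsPiNumber (π i)ᶜ (N₀.relIndex N)
  · exact residual_sup_le_of_inf_le (hHN i P hP) (inf_sup_le_of_isPiNumber_compl hN hN₀ h1
      (hH i P hP) ((hS i).isPiNumber_card P hP))
  by_cases h2 : IsPiNumber (π i) (N₀.relIndex N)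
  · exact residual_sup_le_of_residual_sup_le (hHN i P hP)
      (residual_sup_le_of_isPiNumber hS hdisj hcov hN hN₀ hH hHN h2)
  have h2' := h2
  simp only [IsPiNumber, not_forall, Set.mem_compl_iff, not_not] at h1 h2'
  obtain ⟨p, hpN, hp⟩ := h1
  obtain ⟨q, hqN, hqi⟩ := h2'
  obtain ⟨j, hq⟩ := hcov q
  have hij : i ≠ j := by rintro rfl; exact hqi hq
  have h3 : ¬ IsPiNumber (π j) (N₀.relIndex N) := fun h =>
    Set.disjoint_left.1 (hdisj hij) hp (h p hpN)
  by_contra hbad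
  obtain ⟨A, hHA, hAN, hA, hAH, hAi⟩ :=
    exists_le_normalizer_not_le hS hdisj hN hH ih hHN hij hp hq hpN hqN hP hbad
  have hN₀' : N₀ ≤ N ⊓ H := le_inf hN.le hN₀
  by_cases hgood : ∀ Q ∈ S j, residual (π j) (H ⊔ Q) ≤ H
  · -- compare `A` with `A ∩ W`, where `W ≥ H` is a normal `π j`-subgroup modulo `O^{π j}(H)`
    obtain ⟨hK, W, hHW, hWL, hWn, hW⟩ := (hS j).exists_normal_ge (hH j) hgood
    have hNL : N ≤ H ⊔ sSup (S j) := ((hS j).le_sSup_of_dvd hN hq hqN).trans le_sup_right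
    have hNW : N ≤ normalizer (W : Set G) := hNL.trans hWn
    set U := (residual (π j) H ⊓ N) ⊔ N₀ with hU
    have hUH : U ≤ N ⊓ H := sup_le (le_inf inf_le_right (inf_le_left.trans residual_le)) hN₀'
    have hUV : U ≤ A ⊓ W := le_inf (hUH.trans hHA) (hUH.trans (inf_le_right.trans hHW))
    have hVU : A ⊓ W ≤ U := by
      refine hN.le_of_isPiNumber h3 le_sup_right hUV (inf_le_left.trans hAN) ?_
        (le_normalizer_inf hA hNW) ?_
      · have := hN.normal_left
        exact le_normalizer_sup (le_normalizer_inf (hNL.trans hK) le_normalizer)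
          le_normalizer_of_normal
      · refine IsPiNumber.mono_left ?_ (le_sup_left : _ ≤ U)
        rw [relIndex_inf_of_le (inf_le_left.trans hAN)]
        exact hW.mono_right (hWL.trans hK) inf_le_right
    have hAV : A ≤ A ⊓ W := by
      refine hN.le_of_isPiNumber h2 (le_sup_right.trans hUV) inf_le_left hAN
        (le_normalizer_inf hA hNW) hA (hAi.mono_left ?_)
      exact le_inf hHA (inf_le_right.trans hHW)
    exact hAH ((hAV.trans hVU).trans (hUH.trans inf_le_right))
  · -- two normal subgroups of `N` of coprime index over `N ∩ H`
    push Not at hgood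
    obtain ⟨Q, hQ, hQbad⟩ := hgood
    obtain ⟨B, hHB, hBN, hB, -, hBj⟩ :=
      exists_le_normalizer_not_le hS hdisj hN hH ih hHN hij.symm hq hp hqN hpN hQ hQbad
    have hAB : A ⊓ B ≤ N ⊓ H := le_of_disjoint_relIndex
      (hAi.mid_left (le_inf hHA hHB) inf_le_left) (hBj.mid_left (le_inf hHA hHB) inf_le_right)
      (hdisj hij)
    have hAV : A ≤ A ⊓ B := hN.le_of_isPiNumber h2 (hN₀'.trans (le_inf hHA hHB)) inf_le_left hAN
      (le_normalizer_inf hA hB) hA (hAi.mono_left (le_inf hHA hHB))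
    exact hAH ((hAV.trans hAB).trans inf_le_right)

end family

/-! ### Projectors -/

/-- The definition of `𝔊_π`-projectors in terms of subgroups of `G` and their indices. -/
theorem isProjector_piGroups_iff [Finite G] {π : Set Nat.Primes} {P : Subgroup G} :
    IsProjector (piGroups.{u} π) P ↔ ∀ (N : Subgroup G) [N.Normal], IsPiNumber π (N.relIndex P) ∧
      ∀ T, N ≤ T → P ≤ T → IsPiNumber π (N.relIndex T) → T ≤ N ⊔ P := by
  have hcard : ∀ (N T : Subgroup G) [N.Normal],
      Nat.card (T.map (QuotientGroup.mk' N)) = N.relIndex T := by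
    intro N T _
    rw [← relIndex_ker, QuotientGroup.ker_mk']
  refine forall₂_congr fun N hN => ⟨fun h => ⟨?_, fun T hNT hPT hT => ?_⟩, fun h => ⟨⟨?_, ?_⟩, ?_⟩⟩
  · rw [← hcard]; exact h.1.2
  · have h1 : T.map (QuotientGroup.mk' N) ≤ P.map (QuotientGroup.mk' N) := by
      refine h.2 ⟨inferInstance, ?_⟩ (map_mono hPT)
      rw [hcard]; exact hT
    rw [map_le_iff_le_comap, comap_map_eq, QuotientGroup.ker_mk', sup_comm] at h1
    exact h1
  · infer_instance
  · rw [hcard]; exact h.1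
  · intro K hK hPK
    have hKT : (K.comap (QuotientGroup.mk' N)).map (QuotientGroup.mk' N) = K :=
      map_comap_eq_self_of_surjective (QuotientGroup.mk'_surjective N) K
    have h1 := h.2 (K.comap (QuotientGroup.mk' N)) (QuotientGroup.le_comap_mk' N K)
      (map_le_iff_le_comap.1 hPK) (by rw [← hcard, hKT]; exact hK.2)
    have h2 := map_mono (f := QuotientGroup.mk' N) h1
    rwa [hKT, Subgroup.map_sup, QuotientGroup.map_mk'_self, bot_sup_eq] at h2

section projector

variable {π : Set Nat.Primes} {P Q : Subgroup G}

theorem IsProjector.isPiNumber_card [Finite G] (hP : IsProjector (piGroups.{u} π) P) :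
    IsPiNumber π (Nat.card P) := by
  rw [← relIndex_bot_left]
  exact (isProjector_piGroups_iff.1 hP ⊥).1

theorem IsProjector.smul [Finite G] (hP : IsProjector (piGroups.{u} π) P) (g : G) :
    IsProjector (piGroups.{u} π) (MulAut.conj g • P) := by
  rw [isProjector_piGroups_iff] at hP ⊢
  intro N hN
  have hconj : ∀ x : G, MulAut.conj x • N = N := fun x => Normal.conj_smul_eq_self x N
  refine ⟨?_, fun T hNT hPT hT => ?_⟩
  · rw [← hconj g, relIndex_smul]
    exact (hP N).1
  · rw [← hconj g, ← smul_sup, subset_pointwise_smul_iff, ← map_inv]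
    refine (hP N).2 _ ?_ ?_ ?_
    · rw [← hconj g⁻¹]
      exact pointwise_smul_le_pointwise_smul_iff.2 hNT
    · rwa [map_inv, ← pointwise_smul_subset_iff]
    · rwa [← hconj g⁻¹, relIndex_smul]

/-- If `Q U/U` is a maximal `π`-subgroup of `R/U` for `U = U₁ ∩ U₂` and for `U = U₁ U₂`, then also
for `U = U₁`. -/
theorem le_sup_of_inf_of_sup {R U₁ U₂ T : Subgroup G} (hQ : IsPiNumber π (Nat.card Q))
    (hU₁ : R ≤ normalizer (U₁ : Set G)) (hU₂ : R ≤ normalizer (U₂ : Set G))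
    (hU₂R : U₂ ≤ R) (hQR : Q ≤ R)
    (hinf : ∀ T, T ≤ R → U₁ ⊓ U₂ ≤ T → Q ≤ T → IsPiNumber π ((U₁ ⊓ U₂).relIndex T) →
      T ≤ U₁ ⊓ U₂ ⊔ Q)
    (hsup : ∀ T, T ≤ R → U₁ ⊔ U₂ ≤ T → Q ≤ T → IsPiNumber π ((U₁ ⊔ U₂).relIndex T) →
      T ≤ U₁ ⊔ U₂ ⊔ Q)
    (hTR : T ≤ R) (hT : U₁ ≤ T) (hQT : Q ≤ T) (h : IsPiNumber π (U₁.relIndex T)) :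
    T ≤ U₁ ⊔ Q := by
  have h1 : T ≤ U₁ ⊔ (U₂ ⊔ Q) := by
    rw [← sup_assoc]
    refine le_sup_left.trans (hsup (T ⊔ U₂) (sup_le hTR hU₂R) (sup_le_sup_right hT U₂)
      (hQT.trans le_sup_left) ?_)
    have e : T ⊔ U₂ = (U₁ ⊔ U₂) ⊔ T := by rw [sup_right_comm, sup_eq_right.2 hT]
    rw [e, (permutes_of_le_normalizer (hTR.trans (le_normalizer_sup hU₁ hU₂))).relIndex_sup]
    exact h.mono_left le_sup_left
  set D := (U₂ ⊔ Q) ⊓ T with hD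
  have hDQ : D ≤ U₁ ⊓ U₂ ⊔ Q := by
    refine hinf D (inf_le_right.trans hTR) (le_inf (inf_le_right.trans le_sup_left)
      (inf_le_left.trans hT)) (le_inf le_sup_right hQT) (IsPiNumber.relIndex_inf ?_ ?_
      ((inf_le_right.trans hTR).trans hU₂))
    · exact h.mono_right (hTR.trans hU₁) inf_le_right
    · refine IsPiNumber.mono_right ?_ ((sup_le hU₂R hQR).trans hU₂) inf_le_left
      rw [(permutes_of_le_normalizer (hQR.trans hU₂)).relIndex_sup]
      exact isPiNumber_relIndex_of_card hQ
  have hp : Permutes U₁ (U₂ ⊔ Q) := permutes_of_le_normalizer ((sup_le hU₂R hQR).trans hU₁)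
  exact (le_inf h1 le_rfl).trans ((hp.sup_inf_le hT).trans
    (sup_le le_sup_left (hDQ.trans (sup_le_sup_right inf_le_left Q))))

/-- A projector of `G` contained in a normal subgroup `R` is a projector of `R`. For a normal
subgroup `U` of `R`, one proceeds by induction on the index of `U`, and descends from `U` to the
normal core of `U` in `G` by intersecting with one conjugate of `U` at a time. -/
theorem IsProjector.le_sup [Finite G] (hQ : IsProjector (piGroups.{u} π) Q) {R U T : Subgroup G}
    [R.Normal] (hQR : Q ≤ R) (hUR : U ≤ R) (hU : R ≤ normalizer (U : Set G)) (hTR : T ≤ R)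
    (hUT : U ≤ T) (hQT : Q ≤ T) (h : IsPiNumber π (U.relIndex T)) : T ≤ U ⊔ Q := by
  let ok : Subgroup G → Prop := fun U => ∀ T, T ≤ R → U ≤ T → Q ≤ T →
    IsPiNumber π (U.relIndex T) → T ≤ U ⊔ Q
  suffices main : ok U from main T hTR hUT hQT h
  clear h hQT hUT hTR T
  induction hn : U.index using Nat.strong_induction_on generalizing U with
  | _ n ih =>
  have hconjR : ∀ g : G, MulAut.conj g • R = R := fun g => Normal.conj_smul_eq_self g R
  obtain ⟨V, -, ⟨hcV, hVU, hV, hVok⟩, hmin⟩ := Finite.exists_le_minimal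
    (p := fun V : Subgroup G => U.normalCore ≤ V ∧ V ≤ U ∧ R ≤ normalizer (V : Set G) ∧
      (ok V → ok U)) (a := U) ⟨U.normalCore_le, le_rfl, hU, id⟩
  have hVg : ∀ g : G, V ≤ MulAut.conj g • U := by
    intro g
    by_contra hcon
    have hgU : R ≤ normalizer ((MulAut.conj g • U : Subgroup G) : Set G) :=
      le_normalizer_smul hU (hconjR g)
    have hgR : MulAut.conj g • U ≤ R := by
      rw [← hconjR g]
      exact pointwise_smul_le_pointwise_smul_iff.2 hUR
    have hcg : U.normalCore ≤ MulAut.conj g • U := by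
      rw [← Normal.conj_smul_eq_self g U.normalCore]
      exact pointwise_smul_le_pointwise_smul_iff.2 U.normalCore_le
    refine hcon (le_trans (hmin ⟨le_inf hcV hcg, inf_le_left.trans hVU, le_normalizer_inf hV hgU,
      fun hok => hVok fun T h1 h2 h3 h4 => ?_⟩ inf_le_left) inf_le_right)
    refine le_sup_of_inf_of_sup hQ.isPiNumber_card hV hgU hgR hQR hok ?_ h1 h2 h3 h4
    refine ih _ ?_ (sup_le (hVU.trans hUR) hgR) (le_normalizer_sup hV hgU) rfl
    have hidx : (MulAut.conj g • U).index = U.index := by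
      have := relIndex_smul (H := U) (K := ⊤) g
      rwa [Normal.conj_smul_eq_self g ⊤, relIndex_top_right, relIndex_top_right] at this
    rw [← hn, ← hidx]
    exact index_strictAnti (right_lt_sup.2 hcon)
  have hVc : V ≤ U.normalCore := by
    intro x hx g
    have := hVg g⁻¹ hx
    rw [mem_pointwise_smul_iff_inv_smul_mem, map_inv, inv_inv] at this
    exact this
  refine hVok fun T _ hVT hQT hT => ?_
  rw [le_antisymm hVc hcV] at hVT hT ⊢
  exact (isProjector_piGroups_iff.1 hQ U.normalCore).2 T hVT hQT hT

/-- A normal subgroup of `π`-index is supplemented by a `π`-subgroup: by the Frattini argument and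
the Schur–Zassenhaus theorem, a minimal supplement is a `π`-group. -/
theorem exists_isPiNumber_card_sup_eq_top [Finite G] (N : Subgroup G) [N.Normal]
    (h : IsPiNumber π N.index) : ∃ P : Subgroup G, IsPiNumber π (Nat.card P) ∧ P ⊔ N = ⊤ := by
  obtain ⟨L, -, hL, hmin⟩ := Finite.exists_le_minimal
    (p := fun L : Subgroup G => L ⊔ N = ⊤) (a := ⊤) (top_sup_eq N)
  refine ⟨L, fun p hp => ?_, hL⟩
  by_contra hpπ
  have := Fact.mk p.2
  set J := N.subgroupOf L with hJ
  have hJi : ¬ (p : ℕ) ∣ J.index := fun hd =>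
    hpπ (h p (hd.trans (relIndex_dvd_index_of_normal N L)))
  have hpJ : (p : ℕ) ∣ Nat.card J := by
    rw [← J.card_mul_index] at hp
    exact (p.2.dvd_mul.1 hp).resolve_right hJi
  have hsup : ∀ X : Subgroup L, X ⊔ J = ⊤ → X = ⊤ := by
    intro X hX
    have h1 : X.map L.subtype ⊔ N = ⊤ := by
      rw [eq_top_iff, ← hL]
      refine sup_le ?_ le_sup_right
      have h2 := congrArg (Subgroup.map L.subtype) hX
      rw [Subgroup.map_sup, ← MonoidHom.range_eq_map, range_subtype, hJ, subgroupOf_map_subtype]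
        at h2
      exact h2.ge.trans (sup_le_sup_left inf_le_left _)
    have h3 : L ≤ X.map L.subtype := hmin h1 (map_subtype_le X)
    rw [eq_top_iff]
    intro x _
    obtain ⟨y, hy, hyx⟩ := h3 x.2
    rwa [← Subtype.ext hyx]
  obtain ⟨Y⟩ : Nonempty (Sylow p J) := inferInstance
  set Y' := (Y : Subgroup J).map J.subtype with hY'
  have hYn : Y'.Normal := normalizer_eq_top_iff.1 (hsup _ (Sylow.normalizer_sup_eq_top Y))
  have hcardY : Nat.card Y' = Nat.card Y :=
    Nat.card_congr ((Y : Subgroup J).equivMapOfInjective _ J.subtype_injective).toEquiv.symm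
  have hco : (Nat.card Y').Coprime Y'.index := by
    obtain ⟨k, hk⟩ := IsPGroup.iff_card.1 Y.2
    rw [hcardY, hk, hY', index_map_subtype]
    refine Nat.Coprime.pow_left k ((Nat.Prime.coprime_iff_not_dvd p.2).2 fun hd => ?_)
    exact (p.2.dvd_mul.1 hd).elim Y.not_dvd_index hJi
  obtain ⟨C, hC⟩ := exists_right_complement'_of_coprime hco
  have hCtop : C = ⊤ := by
    refine hsup C (top_le_iff.1 ?_)
    rw [← hC.sup_eq_top, sup_comm]
    exact sup_le_sup_left (map_subtype_le _) C
  have hY1 : Nat.card Y' = 1 := by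
    have hm := hC.card_mul_card
    rw [hCtop, card_top] at hm
    exact Nat.eq_of_mul_eq_mul_right Nat.card_pos (hm.trans (one_mul _).symm)
  have hpY : (p : ℕ) ∣ Nat.card Y := by
    rw [← (Y : Subgroup J).card_mul_index] at hpJ
    exact (p.2.dvd_mul.1 hpJ).resolve_right Y.not_dvd_index
  rw [← hcardY, hY1] at hpY
  exact p.2.ne_one (Nat.dvd_one.1 hpY)

/-- The case of `exists_isProjector` where a minimal normal subgroup has `π`-index. -/
theorem exists_isProjector_of_isPiNumber_index [Finite G] (N₁ : Subgroup G) [N₁.Normal]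
    (hmin : ∀ N : Subgroup G, N.Normal → N ≤ N₁ → N = ⊥ ∨ N = N₁) (h : IsPiNumber π N₁.index) :
    ∃ P : Subgroup G, IsProjector (piGroups.{u} π) P := by
  obtain ⟨P₀, hP₀, hP₀N⟩ := exists_isPiNumber_card_sup_eq_top N₁ h
  obtain ⟨P, hP₀P, hP, hPmax⟩ := Finite.exists_le_maximal
    (p := fun P : Subgroup G => IsPiNumber π (Nat.card P)) (a := P₀) hP₀
  have hPN : P ⊔ N₁ = ⊤ := top_le_iff.1 (hP₀N ▸ sup_le_sup_right hP₀P N₁)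
  refine ⟨P, isProjector_piGroups_iff.2 fun N _ => ⟨isPiNumber_relIndex_of_card hP,
    fun T hNT hPT hT => ?_⟩⟩
  rcases hmin (N₁ ⊓ N) inferInstance inf_le_left with h1 | h1
  · -- `T ∩ N₁` embeds into `T/N`, so that `P (T ∩ N₁)` is a `π`-group
    have h2 : IsPiNumber π ((⊥ : Subgroup G).relIndex (N₁ ⊓ T)) := by
      have h3 : N ⊓ (N₁ ⊓ T) = ⊥ := by
        rw [← inf_assoc, inf_comm N, h1, bot_inf_eq]
      rw [← h3, inf_relIndex_right]
      exact hT.mono_right le_normalizer_of_normal inf_le_right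
    have h4 : P ⊔ N₁ ⊓ T ≤ P := by
      refine hPmax ?_ le_sup_left
      rw [← relIndex_bot_left] at hP ⊢
      refine hP.sup bot_le h2 (permutes_of_le_normalizer ?_).symm
      exact le_normalizer_inf le_normalizer_of_normal (hPT.trans le_normalizer)
    have hp : Permutes P N₁ := (permutes_of_le_normalizer le_normalizer_of_normal).symm
    have h5 : T ≤ (P ⊔ N₁) ⊓ T := by rw [hPN, top_inf_eq]
    exact h5.trans ((hp.sup_inf_le hPT).trans (h4.trans le_sup_right))
  · calc T ≤ P ⊔ N₁ := hPN ▸ le_top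
      _ ≤ N ⊔ P := sup_le le_sup_right ((h1 ▸ inf_le_right).trans le_sup_left)

/-- If `P₁/N₁` is a projector of `G/N₁` and `P` is a projector of `P₁`, then `P` is a projector
of `G`. -/
theorem IsProjector.map_subtype [Finite G] {N₁ P₁ : Subgroup G} [N₁.Normal]
    (hP₁ : IsProjector (piGroups.{u} π) (P₁.map (QuotientGroup.mk' N₁))) (hN₁ : N₁ ≤ P₁)
    {P : Subgroup P₁} (hP : IsProjector (piGroups.{u} π) P) :
    IsProjector (piGroups.{u} π) (P.map P₁.subtype) := by
  have hmk : ∀ H : Subgroup G, N₁ ≤ H →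
      (H.map (QuotientGroup.mk' N₁)).comap (QuotientGroup.mk' N₁) = H := by
    intro H hH
    rw [comap_map_eq, QuotientGroup.ker_mk', sup_eq_left.2 hH]
  have hP₁N : ∀ (N : Subgroup G) [N.Normal] (T : Subgroup G), N₁ ≤ N → N ≤ T → P₁ ≤ T →
      IsPiNumber π (N.relIndex T) → T ≤ N ⊔ P₁ := by
    intro N hN T hN₁N hNT hP₁T hT
    have := hN.map (QuotientGroup.mk' N₁) (QuotientGroup.mk'_surjective N₁)
    have h1 := (isProjector_piGroups_iff.1 hP₁ (N.map (QuotientGroup.mk' N₁))).2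
      (T.map (QuotientGroup.mk' N₁)) (map_mono hNT) (map_mono hP₁T) ?_
    · rwa [← Subgroup.map_sup, map_le_iff_le_comap, hmk _ (hN₁N.trans le_sup_left)] at h1
    · rwa [relIndex_map_map, QuotientGroup.ker_mk', sup_eq_left.2 hN₁N,
        sup_eq_left.2 (hN₁N.trans hNT)]
  set P' := P.map P₁.subtype with hP'
  have hsub : ∀ (N T : Subgroup G) [N.Normal], N ≤ T → P' ≤ T →
      IsPiNumber π (N.relIndex (T ⊓ P₁)) → T ⊓ P₁ ≤ N ⊔ P' := by
    intro N T _ hNT hPT hT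
    have h1 := (isProjector_piGroups_iff.1 hP (N.subgroupOf P₁)).2 (T.subgroupOf P₁)
      (comap_mono hNT) (map_le_iff_le_comap.1 hPT) ?_
    · have h2 := map_mono (f := P₁.subtype) h1
      rw [Subgroup.map_sup, subgroupOf_map_subtype, subgroupOf_map_subtype] at h2
      exact h2.trans (sup_le_sup_right inf_le_left _)
    · rwa [← inf_subgroupOf_right T P₁, relIndex_subgroupOf inf_le_right]
  have hP₁le : P₁ ≤ N₁ ⊔ P' := by
    have := hsub N₁ ⊤ le_top le_top ?_
    · rwa [top_inf_eq] at this
    · rw [top_inf_eq]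
      have := hP₁.isPiNumber_card
      rwa [← relIndex_ker, QuotientGroup.ker_mk'] at this
  refine isProjector_piGroups_iff.2 fun N _ => ⟨?_, fun T hNT hPT hT => ?_⟩
  · refine isPiNumber_relIndex_of_card ?_
    rw [hP', card_map_of_injective P₁.subtype_injective]
    exact hP.isPiNumber_card
  · have h1 : T ≤ N ⊔ P₁ := by
      have h2 := hP₁N (N ⊔ N₁) (T ⊔ N₁) le_sup_right (sup_le_sup_right hNT N₁)
        (hP₁le.trans (sup_le le_sup_right (hPT.trans le_sup_left))) ?_
      · exact le_sup_left.trans (h2.trans (sup_le (sup_le_sup_left hN₁ N) le_sup_right))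
      · have e : T ⊔ N₁ = (N ⊔ N₁) ⊔ T := by rw [sup_right_comm, sup_eq_right.2 hNT]
        rw [e, (permutes_of_le_normalizer le_normalizer_of_normal).relIndex_sup]
        exact hT.mono_left le_sup_left
    have hp : Permutes N P₁ := permutes_of_le_normalizer le_normalizer_of_normal
    refine (le_inf h1 le_rfl).trans ((hp.sup_inf_le hNT).trans (sup_le le_sup_left ?_))
    rw [inf_comm]
    exact hsub N T hNT hPT (hT.mono_right le_normalizer_of_normal inf_le_left)

/-- Every finite group has a `𝔊_π`-projector. -/
theorem exists_isProjector (π : Set Nat.Primes) (G : Type u) [Group G] [Finite G] :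
    ∃ P : Subgroup G, IsProjector (piGroups.{u} π) P := by
  induction hn : Nat.card G using Nat.strong_induction_on generalizing G with
  | _ n ih =>
  by_cases hG : IsPiNumber π (Nat.card G)
  · refine ⟨⊤, isProjector_piGroups_iff.2 fun N _ => ⟨?_, fun T _ _ _ => ?_⟩⟩
    · exact isPiNumber_relIndex_of_card (by rwa [card_top])
    · rw [sup_top_eq]; exact le_top
  have hbot : (⊤ : Subgroup G) ≠ ⊥ := by
    intro h
    rw [← card_top (G := G), h, card_bot] at hG
    exact hG IsPiNumber.one
  obtain ⟨N₁, -, ⟨hN₁, hN₁ne⟩, hmin⟩ := Finite.exists_le_minimal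
    (p := fun N : Subgroup G => N.Normal ∧ N ≠ ⊥) (a := ⊤) ⟨inferInstance, hbot⟩
  have hmin' : ∀ N : Subgroup G, N.Normal → N ≤ N₁ → N = ⊥ ∨ N = N₁ := by
    intro N hN hle
    by_cases h : N = ⊥
    · exact Or.inl h
    · exact Or.inr (le_antisymm hle (hmin ⟨hN, h⟩ hle))
  have hlt : Nat.card (G ⧸ N₁) < n := by
    rw [← hn, N₁.card_eq_card_quotient_mul_card_subgroup]
    exact lt_mul_of_one_lt_right Nat.card_pos (N₁.one_lt_card_iff_ne_bot.2 hN₁ne)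
  obtain ⟨P₁, hP₁⟩ := ih _ hlt (G ⧸ N₁) rfl
  have hP₁map : (P₁.comap (QuotientGroup.mk' N₁)).map (QuotientGroup.mk' N₁) = P₁ :=
    map_comap_eq_self_of_surjective (QuotientGroup.mk'_surjective N₁) P₁
  by_cases htop : P₁.comap (QuotientGroup.mk' N₁) = ⊤
  · refine exists_isProjector_of_isPiNumber_index N₁ hmin' ?_
    have := hP₁.isPiNumber_card
    rwa [← hP₁map, htop, ← relIndex_ker, QuotientGroup.ker_mk', relIndex_top_right] at this
  · have hlt₁ : Nat.card (P₁.comap (QuotientGroup.mk' N₁)) < n := by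
      rw [← hn]
      exact lt_of_le_of_ne (card_le_card_group _) fun h => htop (eq_top_of_card_eq _ h)
    obtain ⟨P, hP⟩ := ih _ hlt₁ (P₁.comap (QuotientGroup.mk' N₁)) rfl
    refine ⟨_, IsProjector.map_subtype (N₁ := N₁) ?_ (QuotientGroup.le_comap_mk' N₁ P₁) hP⟩
    rwa [hP₁map]

end projector

/-! ### Permuting with projectors -/

/-- `O^{π'}(G)`, the subgroup generated by all `π`-elements of `G`. -/
def piGenerated (G : Type u) [Group G] (π : Set Nat.Primes) : Subgroup G :=
  closure {g | IsPiNumber π (orderOf g)}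

section piGenerated

variable {π : Set Nat.Primes} {P Q : Subgroup G}

theorem le_piGenerated [Finite G] (h : IsPiNumber π (Nat.card P)) : P ≤ piGenerated G π :=
  fun _ hx => subset_closure (h.of_dvd (P.orderOf_dvd_natCard hx))

theorem IsGeneratingFamily.sSup_eq [Finite G] {S : Set (Subgroup G)}
    (hS : IsGeneratingFamily π S) : sSup S = piGenerated G π :=
  le_antisymm (sSup_le fun P hP => le_piGenerated (hS.isPiNumber_card P hP))
    ((closure_le _).2 fun g hg => hS.mem_sSup g hg)

theorem IsProjector.isGeneratingFamily [Finite G] (hP : IsProjector (piGroups.{u} π) P) :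
    IsGeneratingFamily π {C | ∃ g : G, C = MulAut.conj g • P} := by
  have hsmul : ∀ C ∈ {C | ∃ g : G, C = MulAut.conj g • P}, ∀ g : G,
      MulAut.conj g • C ∈ {C | ∃ g : G, C = MulAut.conj g • P} := by
    rintro _ ⟨x, rfl⟩ g
    exact ⟨g * x, by rw [smul_smul, map_mul]⟩
  refine ⟨hsmul, ?_, fun g hg => ?_⟩
  · rintro _ ⟨g, rfl⟩
    exact (hP.smul g).isPiNumber_card
  · have hR : {C | ∃ g : G, C = MulAut.conj g • P} = {C | ∃ g ∈ (⊤ : Subgroup G),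
        C = MulAut.conj g • P} := by simp
    change g ∈ sSup _
    rw [hR]
    change g ∈ closureIn ⊤ P
    have := normal_closureIn_top (M := P)
    have h1 := (isProjector_piGroups_iff.1 hP (closureIn ⊤ P)).2 (closureIn ⊤ P ⊔ zpowers g)
      le_sup_left (le_closureIn.trans le_sup_left) ?_
    · rw [sup_eq_left.2 le_closureIn] at h1
      exact h1 (mem_sup_right (mem_zpowers g))
    · rw [(permutes_of_le_normalizer le_normalizer_of_normal).relIndex_sup]
      exact isPiNumber_relIndex_of_card (by rwa [Nat.card_zpowers])

/-- A criterion for permuting with a projector `Q`: if `D` is a `π`-group modulo `K`, and lies in a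
subgroup `W` such that `(W ∩ R)/(K ∩ R)` is a normal `π`-subgroup of `R/(K ∩ R)`, where
`R = O^{π'}(G)`, then `D` is contained in `K Q`. -/
theorem IsProjector.permutes [Finite G] (hQ : IsProjector (piGroups.{u} π) Q) {D K W : Subgroup G}
    (hKD : K ≤ D) (hDW : D ≤ W) (hK : piGenerated G π ≤ normalizer (K : Set G))
    (hW : piGenerated G π ≤ normalizer (W : Set G))
    (hKW : IsPiNumber π (K.relIndex (W ⊓ piGenerated G π)))
    (hKDπ : IsPiNumber π (K.relIndex D)) : Permutes D Q := by
  set R := piGenerated G π with hR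
  have hRn : R.Normal := by
    rw [hR, ← hQ.isGeneratingFamily.sSup_eq]
    exact hQ.isGeneratingFamily.normal_sSup
  have hQR : Q ≤ R := le_piGenerated hQ.isPiNumber_card
  have hWR : R ≤ normalizer ((W ⊓ R : Subgroup G) : Set G) := le_normalizer_inf hW le_normalizer
  have hWQ : W ⊓ R ≤ K ⊔ Q := by
    have h1 : W ⊓ R ⊔ Q ≤ K ⊓ R ⊔ Q := by
      refine hQ.le_sup hQR inf_le_right (le_normalizer_inf hK le_normalizer)
        (sup_le inf_le_right hQR) ((inf_le_inf_right R (hKD.trans hDW)).trans le_sup_left)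
        le_sup_right (IsPiNumber.trans (K := W ⊓ R) ?_ ?_ (inf_le_inf_right R (hKD.trans hDW))
        le_sup_left)
      · rwa [relIndex_inf_of_le inf_le_right]
      · rw [(permutes_of_le_normalizer (hQR.trans hWR)).relIndex_sup]
        exact isPiNumber_relIndex_of_card hQ.isPiNumber_card
    exact le_sup_left.trans (h1.trans (sup_le_sup_right inf_le_left Q))
  have hDR : D ≤ K ⊔ D ⊓ R := by
    refine le_of_disjoint_relIndex (hKDπ.mono_left le_sup_left) ?_ (disjoint_compl_right (a := π))
    refine IsPiNumber.mono_left (H := D ⊓ R) ?_ le_sup_right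
    rw [inf_comm, inf_relIndex_right]
    intro p hp hpπ
    refine not_dvd_relIndex_of_forall_mem p.2 ?_ hp
    rintro g - ⟨k, hk⟩
    exact subset_closure (isPiNumber_orderOf_of_eq_pow hpπ hk)
  have hDQ : D ⊔ Q ≤ K ⊔ Q := by
    refine sup_le (hDR.trans (sup_le le_sup_left ?_)) le_sup_right
    exact (inf_le_inf_right R hDW).trans hWQ
  refine permutes_of_coe_sup fun x hx => ?_
  obtain ⟨k, hk, q, hq, rfl⟩ :=
    (permutes_of_le_normalizer (hQR.trans hK)).mem_sup.1 (hDQ hx)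
  exact ⟨k, hKD hk, q, hq, rfl⟩

end piGenerated

/-- The structure of a `σ⁽³⁾`-permutable subgroup `H`, for `π ∈ σ`: the subgroup `R = O^{π'}(G)`
normalizes `O^π(H)`, and `H` lies in a subgroup normalized by `R` and of `π`-index over `O^π(H)`.
This no longer refers to any projector. -/
theorem IsSigma3Permutable.exists_normal_ge [Finite G] {σ : Set (Set Nat.Primes)}
    (hσ : Setoid.IsPartition σ) {H : Subgroup G} (hH : IsSigma3Permutable.{u} σ H)
    {π : Set Nat.Primes} (hπ : π ∈ σ) :
    piGenerated G π ≤ normalizer (residual π H : Set G) ∧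
      ∃ W, H ≤ W ∧ piGenerated G π ≤ normalizer (W : Set G) ∧
        IsPiNumber π ((residual π H).relIndex (W ⊓ piGenerated G π)) := by
  choose! P hP hHP using hH
  let S : σ → Set (Subgroup G) := fun i => {C | ∃ g : G, C = MulAut.conj g • P i}
  have hS : ∀ i : σ, IsGeneratingFamily (i : Set Nat.Primes) (S i) := fun i =>
    (hP i i.2).isGeneratingFamily
  have hdisj : Pairwise fun i j : σ => Disjoint (i : Set Nat.Primes) (j : Set Nat.Primes) :=
    fun i j hij => hσ.pairwiseDisjoint i.2 j.2 fun h => hij (Subtype.ext h)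
  have hcov : ∀ p, ∃ i : σ, p ∈ (i : Set Nat.Primes) := by
    intro p
    obtain ⟨κ, ⟨hκ, hp⟩, -⟩ := hσ.2 p
    exact ⟨⟨κ, hκ⟩, hp⟩
  have hperm : ∀ i : σ, ∀ C ∈ S i, Permutes H C := by
    rintro i _ ⟨g, rfl⟩
    simpa [conjBy] using hHP i i.2 g⁻¹
  have hres := residual_sup_le hS hdisj hcov H hperm ⟨π, hπ⟩
  obtain ⟨hK, W, hHW, hWL, hW, hKW⟩ := (hS ⟨π, hπ⟩).exists_normal_ge (hperm _) hres
  rw [(hS ⟨π, hπ⟩).sSup_eq] at hK hWL hW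
  exact ⟨le_sup_right.trans hK, W, hHW, le_sup_right.trans hW,
    hKW.mono_right (hWL.trans hK) inf_le_left⟩

/-- A `σ⁽³⁾`-permutable subgroup permutes with all `𝔊_π`-projectors, for all `π ∈ σ`. -/
theorem IsSigma3Permutable.permutes [Finite G] {σ : Set (Set Nat.Primes)}
    (hσ : Setoid.IsPartition σ) {H : Subgroup G} (hH : IsSigma3Permutable.{u} σ H)
    {π : Set Nat.Primes} (hπ : π ∈ σ) {Q : Subgroup G} (hQ : IsProjector (piGroups.{u} π) Q) :
    Permutes H Q := by
  obtain ⟨hK, W, hHW, hW, hKW⟩ := hH.exists_normal_ge hσ hπ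
  exact hQ.permutes residual_le hHW hK hW hKW isPiNumber_relIndex_residual

theorem IsSigma3Permutable.inf_permutes [Finite G] {σ : Set (Set Nat.Primes)}
    (hσ : Setoid.IsPartition σ) {A B : Subgroup G} (hA : IsSigma3Permutable.{u} σ A)
    (hB : IsSigma3Permutable.{u} σ B) {π : Set Nat.Primes} (hπ : π ∈ σ) {Q : Subgroup G}
    (hQ : IsProjector (piGroups.{u} π) Q) : Permutes (A ⊓ B) Q := by
  obtain ⟨hK, W, hAW, hW, hKW⟩ := hA.exists_normal_ge hσ hπ
  obtain ⟨hL, V, hBV, hV, hLV⟩ := hB.exists_normal_ge hσ hπ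
  refine hQ.permutes (inf_le_inf residual_le residual_le) (inf_le_inf hAW hBV)
    (le_normalizer_inf hK hL) (le_normalizer_inf hW hV) ?_ ?_
  · refine IsPiNumber.relIndex_inf ?_ ?_ (inf_le_right.trans hL)
    · exact hKW.mono_right (inf_le_right.trans hK) (inf_le_inf_right _ inf_le_left)
    · exact hLV.mono_right (inf_le_right.trans hL) (inf_le_inf_right _ inf_le_right)
  · refine IsPiNumber.relIndex_inf ?_ ?_ (inf_le_right.trans le_normalizer_residual)
    · exact isPiNumber_relIndex_residual.mono_right le_normalizer_residual inf_le_left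
    · exact isPiNumber_relIndex_residual.mono_right le_normalizer_residual inf_le_right

end SigmaPerm

theorem theorem4 {G : Type u} [Group G] [Finite G] (σ : Set (Set Nat.Primes))
    (hσ : Setoid.IsPartition σ) :
    {H : Subgroup G | SigmaPerm.IsSigma3Permutable σ H}.Nonempty ∧
      IsSublattice {H : Subgroup G | SigmaPerm.IsSigma3Permutable σ H} := by
  refine ⟨⟨⊥, fun π _ => ?_⟩, fun A hA B hB π hπ => ?_, fun A hA B hB π hπ => ?_⟩
  · obtain ⟨P, hP⟩ := SigmaPerm.exists_isProjector π G
    exact ⟨P, hP, fun x => SigmaPerm.Permutes.symm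
      (SigmaPerm.permutes_of_le_normalizer (bot_le.trans Subgroup.le_normalizer))⟩
  · obtain ⟨P, hP, hAP⟩ := hA π hπ
    exact ⟨P, hP, fun x => (hAP x).sup (hB.permutes hσ hπ (hP.smul x⁻¹))⟩
  · obtain ⟨P, hP, -⟩ := hA π hπ
    exact ⟨P, hP, fun x => hA.inf_permutes hσ hB hπ (hP.smul x⁻¹)⟩
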